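/- Let $dw$ be Lebesgue measure on $\mathbb C$ and, for $\varepsilon>0$, let $Q(x,\varepsilon)$ be the closed square with sides parallel to the axes, centre $x$ and side length $\varepsilon$; put $Q_0=Q(0,2)=[-1,1]^2$. Let $$Bf(z)=\lim_{\varepsilon\to0^+}\frac{-1}{\pi}\int_{|w|>\varepsilon}\frac{f(z-w)}{w^2}\,dw,\qquad B^*_Sf(z)=\sup_{\varepsilon>0}\left|\frac{-1}{\pi}\int_{w\notin Q(0,\varepsilon)}\frac{f(z-w)}{w^2}\,dw\right|,$$ be the Beurling transform and its maximal transform associated with squares, and let $Mf(z)=\sup_{r>0}\frac1{|D(z,r)|}\int_{D(z,r)}|f(w)|\,dw$ be the Hardy--Littlewood maximal function. Let $$f(z)=B^{-1}(\chi_{Q_0})(z)=\lim_{\varepsilon\to0^+}\frac{-1}{\pi}\int_{|w|>\varepsilon}\frac{\chi_{Q_0}(z-w)}{\overline w^{\,2}}\,dw .$$ Then this limit exists for almost every $z$, $f\in L^2(\mathbb C)$, and $Bf=\chi_{Q_0}$, the limit defining $Bf$ existing almost everywhere. Moreover: 1. There are $c>0$ and $\alpha_0$ such that, for all $\alpha\ge\alpha_0$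 and $z=\alpha+i\alpha$, $\displaystyle B^*_Sf(z)\ge c\,\frac{\log|z|}{|z|^2}$. 2. There is $C\ge1$ such that $C^{-1}|z|^{-2}\le M(Bf)(z)\le C|z|^{-2}$ for all $z$ with $|z|>2$. 3. For every constant $C\ge 0$ there is $z\in\mathbb C$ with $|z|>2$ and $B^*_Sf(z)>C\,M(Bf)(z)$; that is, $B^*_Sf/M(Bf)$ is unbounded. Consequently there is no constant $C$ such that $B^*_Sg(z)\le C\,M(Bg)(z)$ for all $g\in L^2(\mathbb C)$ and all $z\in\mathbb C$. -/

import Mathlib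

open MeasureTheory Filter Topology
open scoped ENNReal NNReal ComplexConjugate

noncomputable section

/-- The closed square `Q(x, ℓ)` in `ℂ`, with sides parallel to the axes, centre `x`, side length `ℓ`. -/
def axisSquare (x : ℂ) (l : ℝ) : Set ℂ :=
  {w : ℂ | |(w - x).re| ≤ l / 2 ∧ |(w - x).im| ≤ l / 2}

/-- The kernel `-1 / (π w²)` of the Beurling transform. -/
def beurlingKernel (w : ℂ) : ℂ := -1 / ((Real.pi : ℂ) * w ^ 2)

/-- Truncation outside the disc of radius `ε` of the convolution of `f` with the kernel `K`. -/
def discTruncation (K : ℂ → ℂ) (ε : ℝ) (f : ℂ → ℂ) (z : ℂ) : ℂ :=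
  ∫ w in {w : ℂ | ε < ‖w‖}, f (z - w) * K w

/-- The principal value of the convolution of `f` with `K` exists at `z` and equals `a`. -/
def HasPrincipalValue (K : ℂ → ℂ) (f : ℂ → ℂ) (z a : ℂ) : Prop :=
  Tendsto (fun ε : ℝ => discTruncation K ε f z) (𝓝[>] 0) (𝓝 a)

/-- The principal value convolution of `f` with `K` (meaningful where the limit exists). -/
def principalValue (K : ℂ → ℂ) (f : ℂ → ℂ) (z : ℂ) : ℂ :=
  limUnder (𝓝[>] (0 : ℝ)) (fun ε : ℝ => discTruncation K ε f z)

/-- The Beurling transform `B`. -/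
def beurling (f : ℂ → ℂ) : ℂ → ℂ := principalValue beurlingKernel f

/-- The inverse `B⁻¹` of the Beurling transform: principal value convolution with the conjugate
kernel. -/
def beurlingInv (g : ℂ → ℂ) : ℂ → ℂ := principalValue (fun w => conj (beurlingKernel w)) g

/-- The truncated Beurling transform outside the square of side length `ε`. -/
def beurlingSquareTruncation (ε : ℝ) (f : ℂ → ℂ) (z : ℂ) : ℂ :=
  ∫ w in (axisSquare 0 ε)ᶜ, f (z - w) * beurlingKernel w

/-- The maximal Beurling transform associated with squares, with values in `[0, ∞]`. -/
def maximalBeurlingSquare (f : ℂ → ℂ) (z : ℂ) : ℝ≥0∞ :=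
  ⨆ (ε : ℝ) (_ : 0 < ε), ‖beurlingSquareTruncation ε f z‖ₑ

/-- The (centred) Hardy–Littlewood maximal function, with values in `[0, ∞]`. -/
def hardyLittlewoodMaximal (f : ℂ → ℂ) (z : ℂ) : ℝ≥0∞ :=
  ⨆ (r : ℝ) (_ : 0 < r), (∫⁻ w in Metric.ball z r, ‖f w‖ₑ) / volume (Metric.ball z r)

end

/-! Identity `B f = χ`. The conjugate Beurling kernel is regularised to `kernelReg δ`, which is `∂̄`
of the smooth potential `cauchyReg δ`, while `∂` of that potential is the approximate identity
`approxId δ`. Two Green formulas, `setIntegral_disc_wirtinger` for `∂V` on a disc and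
`setIntegral_annulus_wirtinger` for `∂̄V / w²` on an annulus, produce the same circle integral.
Hence truncating `B` at radius `ε` on a translate of `kernelReg δ` gives the mean of `approxId δ`
over a disc of radius `ε` (`setIntegral_kernelReg_mul_beurlingKernel`). Integrating over the square
and letting `δ → 0`, the disc truncations of `B f` are exactly the disc averages of `χ`
(`discTruncation_beurlingInv_squareInd`). Off the four lines carrying the sides they equal `χ(z)`
for small `ε`, so the limit exists almost everywhere without any `L²` theory of singular integrals.
Membership `f ∈ L²` and the dominated convergence rest on one majorant, uniform in `δ`
(`norm_squareTransform_le`).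

Lower bound. Write `K` for the Beurling kernel. At infinity `f(w) = 4 conj K(w) + O(|w|⁻³)`, the
factor 4 being the area of the square. For `z = α + iα` the square of side `2α` about `z` has a
corner at the origin, so its complement meets the disc `|w| ≤ α` in three quadrants. Over a full
annulus `conj K` integrates to zero; with one quadrant missing the integral over `4 < |w| ≤ α` is
`(i/π) log(α/4)`. As `K(z - w)` is close to `K(z)`, of size `1/(2πα²)`, the truncation has size
about `log α / α²`, and all other contributions are `O(α⁻²)`
(`exists_le_norm_beurlingSquareTruncation_corner`).

Conclusion. `M χ` is comparable to `|z|⁻²` away from the square, so the logarithm makes the quotient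
unbounded. -/

/-! ### Green's formulas in polar coordinates -/

theorem setIntegral_annulus_polar {a b : ℝ} (ha : 0 ≤ a) (hab : a ≤ b) {Ψ : ℂ → ℂ}
    (hΨ : ContinuousOn (fun p : ℝ × ℝ => (p.1 : ℂ) * Ψ (p.1 * Complex.exp (p.2 * Complex.I)))
      (Set.Icc a b ×ˢ Set.Icc (-Real.pi) Real.pi)) :
    ∫ w in {w : ℂ | a < ‖w‖ ∧ ‖w‖ < b}, Ψ w =
      ∫ r in a..b, ∫ θ in (-Real.pi)..Real.pi,
        (r : ℂ) * Ψ (r * Complex.exp (θ * Complex.I)) := by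
  have hpi : -Real.pi ≤ Real.pi := by linarith [Real.pi_pos]
  have hS : MeasurableSet {w : ℂ | a < ‖w‖ ∧ ‖w‖ < b} :=
    (measurableSet_lt measurable_const measurable_norm).inter
      (measurableSet_lt measurable_norm measurable_const)
  rw [← integral_indicator hS, ← Complex.integral_comp_polarCoord_symm]
  have hT : MeasurableSet (Set.Ioo a b ×ˢ Set.Ioo (-Real.pi) Real.pi) :=
    measurableSet_Ioo.prod measurableSet_Ioo
  have h1 : ∀ p ∈ polarCoord.target,
      p.1 • ({w : ℂ | a < ‖w‖ ∧ ‖w‖ < b}.indicator Ψ (Complex.polarCoord.symm p)) =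
      (Set.Ioo a b ×ˢ Set.Ioo (-Real.pi) Real.pi).indicator
        (fun p : ℝ × ℝ => (p.1 : ℂ) * Ψ (p.1 * Complex.exp (p.2 * Complex.I))) p := by
    rintro ⟨r, θ⟩ ⟨hr, hθ⟩
    simp only [Set.mem_Ioi] at hr
    by_cases h : a < r ∧ r < b
    · rw [Set.indicator_of_mem, Set.indicator_of_mem (by exact ⟨h, hθ⟩)]
      · simp [Complex.exp_mul_I]
      · simpa [abs_of_pos hr] using h
    · rw [Set.indicator_of_notMem, Set.indicator_of_notMem, smul_zero]
      · exact fun hh => h hh.1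
      · simpa [abs_of_pos hr] using h
  rw [setIntegral_congr_fun polarCoord.open_target.measurableSet h1, setIntegral_indicator hT]
  have h2 : polarCoord.target ∩ Set.Ioo a b ×ˢ Set.Ioo (-Real.pi) Real.pi =
      Set.Ioo a b ×ˢ Set.Ioo (-Real.pi) Real.pi := by
    apply Set.inter_eq_right.2
    rintro ⟨r, θ⟩ ⟨hr, hθ⟩
    exact ⟨ha.trans_lt hr.1, hθ⟩
  rw [h2, Measure.volume_eq_prod, setIntegral_prod, intervalIntegral.integral_of_le hab,
    integral_Ioc_eq_integral_Ioo]
  · simp only [intervalIntegral.integral_of_le hpi, integral_Ioc_eq_integral_Ioo]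
  · rw [← Measure.volume_eq_prod]
    exact (hΨ.integrableOn_compact (isCompact_Icc.prod isCompact_Icc)).mono_set
      (Set.prod_mono Set.Ioo_subset_Icc_self Set.Ioo_subset_Icc_self)

/-- The real-linear map `h ↦ a h + b conj h`. -/
noncomputable def wirtingerCLM (a b : ℂ) : ℂ →L[ℝ] ℂ :=
  a • ContinuousLinearMap.id ℝ ℂ + b • (Complex.conjCLE : ℂ →L[ℝ] ℂ)

theorem wirtingerCLM_apply (a b h : ℂ) : wirtingerCLM a b h = a * h + b * conj h := by
  simp [wirtingerCLM]

/-- `V (r e^{iθ}) e^{-iθ}` as a function of the polar coordinates `(r, θ)`. -/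
noncomputable def polarTwist (V : ℂ → ℂ) (p : ℝ × ℝ) : ℂ :=
  V (p.1 * Complex.exp (p.2 * Complex.I)) * Complex.exp (-(p.2 * Complex.I))

/-- The derivative of `polarTwist V` when `V` has Wirtinger derivatives `A`, `B`. -/
noncomputable def polarTwistDeriv (V A B : ℂ → ℂ) (p : ℝ × ℝ) : ℝ × ℝ →L[ℝ] ℂ :=
  (ContinuousLinearMap.fst ℝ ℝ ℝ).smulRight
    (A (p.1 * Complex.exp (p.2 * Complex.I)) +
      B (p.1 * Complex.exp (p.2 * Complex.I)) * Complex.exp (-(p.2 * Complex.I)) ^ 2) +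
  (ContinuousLinearMap.snd ℝ ℝ ℝ).smulRight
    (Complex.I * p.1 * (A (p.1 * Complex.exp (p.2 * Complex.I)) -
      B (p.1 * Complex.exp (p.2 * Complex.I)) * Complex.exp (-(p.2 * Complex.I)) ^ 2) -
      Complex.I * polarTwist V p)

/-- Along `w = r e^{iθ}` one has `dw = e^{iθ}(dr + i r dθ)`. The twist by `e^{-iθ}` therefore leaves
`A` without oscillation and `B` with the factor `e^{-2iθ}`, and it contributes the extra term `-iW`
to the angular derivative of the twisted function `W`. -/
theorem hasFDerivAt_polarTwist {V A B : ℂ → ℂ}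
    (hV : ∀ w, HasFDerivAt V (wirtingerCLM (A w) (B w)) w) (p : ℝ × ℝ) :
    HasFDerivAt (polarTwist V) (polarTwistDeriv V A B p) p := by
  have h1 : HasFDerivAt (fun p : ℝ × ℝ => (p.1 : ℂ))
      (Complex.ofRealCLM.comp (ContinuousLinearMap.fst ℝ ℝ ℝ)) p :=
    Complex.ofRealCLM.hasFDerivAt.comp p hasFDerivAt_fst
  have h2 : HasFDerivAt (fun p : ℝ × ℝ => (p.2 : ℂ) * Complex.I)
      ((Complex.ofRealCLM.comp (ContinuousLinearMap.snd ℝ ℝ ℝ)).smulRight Complex.I) p := by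
    have := (Complex.ofRealCLM.hasFDerivAt.comp p hasFDerivAt_snd : HasFDerivAt
      (fun p : ℝ × ℝ => (p.2 : ℂ)) (Complex.ofRealCLM.comp (ContinuousLinearMap.snd ℝ ℝ ℝ)) p)
    refine (this.mul_const Complex.I).congr_fderiv ?_
    ext <;> simp
  have h3 := h1.mul h2.cexp
  have h4 := ((hV (p.1 * Complex.exp (p.2 * Complex.I))).comp p h3).mul h2.neg.cexp
  refine h4.congr_fderiv ?_
  have hc : ∀ θ : ℝ, conj (Complex.exp (θ * Complex.I)) = Complex.exp (-(θ * Complex.I)) := by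
    intro θ
    rw [← Complex.exp_conj]
    simp
  have he : ∀ θ : ℝ, Complex.exp (θ * Complex.I) * Complex.exp (-(θ * Complex.I)) = 1 := by
    intro θ
    rw [← Complex.exp_add]
    simp
  ext
  · simp [polarTwistDeriv, wirtingerCLM_apply, hc]
    linear_combination A (p.1 * Complex.exp (p.2 * Complex.I)) * he p.2
  · simp [polarTwistDeriv, wirtingerCLM_apply, hc, polarTwist]
    linear_combination Complex.I * p.1 * A (p.1 * Complex.exp (p.2 * Complex.I)) * he p.2

theorem polarTwist_pi (V : ℂ → ℂ) (r : ℝ) :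
    polarTwist V (r, Real.pi) = polarTwist V (r, -Real.pi) := by
  simp [polarTwist, Complex.exp_neg]

/-- The divergence theorem on a rectangle for a field that is periodic in the second variable. -/
theorem integral_divergence_of_periodic {f g Θ : ℝ × ℝ → ℂ} {f' g' : ℝ × ℝ → ℝ × ℝ →L[ℝ] ℂ}
    {a b : ℝ} (hab : a ≤ b) (hf : ∀ p : ℝ × ℝ, a ≤ p.1 → HasFDerivAt f (f' p) p)
    (hg : ∀ p : ℝ × ℝ, a ≤ p.1 → HasFDerivAt g (g' p) p)
    (hsum : ∀ p : ℝ × ℝ, a ≤ p.1 → f' p (1, 0) + g' p (0, 1) = Θ p)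
    (hΘ : ContinuousOn Θ (Set.Icc a b ×ˢ Set.Icc (-Real.pi) Real.pi))
    (hper : ∀ r, g (r, Real.pi) = g (r, -Real.pi)) :
    ∫ r in a..b, ∫ θ in (-Real.pi)..Real.pi, Θ (r, θ) =
      (∫ θ in (-Real.pi)..Real.pi, f (b, θ)) - ∫ θ in (-Real.pi)..Real.pi, f (a, θ) := by
  have hpi : -Real.pi ≤ Real.pi := by linarith [Real.pi_pos]
  have hI : Set.uIcc a b ×ˢ Set.uIcc (-Real.pi) Real.pi =
      Set.Icc a b ×ˢ Set.Icc (-Real.pi) Real.pi := by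
    rw [Set.uIcc_of_le hab, Set.uIcc_of_le hpi]
  have hmem : ∀ p ∈ Set.Ioo (min a b) (max a b) ×ˢ
      Set.Ioo (min (-Real.pi) Real.pi) (max (-Real.pi) Real.pi) \ ∅, a ≤ p.1 := by
    rintro p ⟨⟨hp, -⟩, -⟩
    rw [min_eq_left hab] at hp
    exact hp.1.le
  have key := integral2_divergence_prod_of_hasFDerivAt_off_countable
    f g f' g' a (-Real.pi) b Real.pi ∅ Set.countable_empty
    (by rw [hI]; exact fun p hp => (hf p hp.1.1).continuousAt.continuousWithinAt)
    (by rw [hI]; exact fun p hp => (hg p hp.1.1).continuousAt.continuousWithinAt)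
    (fun p hp => hf p (hmem p hp)) (fun p hp => hg p (hmem p hp)) (by
      rw [hI]
      apply ContinuousOn.integrableOn_compact (isCompact_Icc.prod isCompact_Icc)
      exact hΘ.congr fun p hp => hsum p hp.1.1)
  simp only [hper, sub_self, zero_add] at key
  rw [← key]
  refine intervalIntegral.integral_congr fun r hr => ?_
  rw [Set.uIcc_of_le hab] at hr
  exact intervalIntegral.integral_congr fun θ _ => (hsum (r, θ) hr.1).symm

theorem hasFDerivAt_ofReal_fst (p : ℝ × ℝ) : HasFDerivAt (fun p : ℝ × ℝ => (p.1 : ℂ))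
    (Complex.ofRealCLM.comp (ContinuousLinearMap.fst ℝ ℝ ℝ)) p :=
  Complex.ofRealCLM.hasFDerivAt.comp p hasFDerivAt_fst

theorem hasFDerivAt_inv_ofReal_fst (p : ℝ × ℝ) (hp : (p.1 : ℂ) ≠ 0) :
    HasFDerivAt (fun p : ℝ × ℝ => (p.1 : ℂ)⁻¹)
      ((-((p.1 : ℂ) ^ 2)⁻¹) • (Complex.ofRealCLM.comp (ContinuousLinearMap.fst ℝ ℝ ℝ))) p :=
  (hasDerivAt_inv hp).comp_hasFDerivAt p (hasFDerivAt_ofReal_fst p)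

/-- The derivative of `p ↦ W p / p.1`, where `W` has derivative `D` and value `v` at `p`. -/
noncomputable def invFstMulDeriv (p : ℝ × ℝ) (v : ℂ) (D : ℝ × ℝ →L[ℝ] ℂ) : ℝ × ℝ →L[ℝ] ℂ :=
  (p.1 : ℂ)⁻¹ • D + v • ((-((p.1 : ℂ) ^ 2)⁻¹) •
    (Complex.ofRealCLM.comp (ContinuousLinearMap.fst ℝ ℝ ℝ)))

theorem hasFDerivAt_invFst_mul {W : ℝ × ℝ → ℂ} {D : ℝ × ℝ →L[ℝ] ℂ} {p : ℝ × ℝ}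
    (hp : (p.1 : ℂ) ≠ 0) (hW : HasFDerivAt W D p) :
    HasFDerivAt (fun q : ℝ × ℝ => (q.1 : ℂ)⁻¹ * W q) (invFstMulDeriv p (W p) D) p :=
  (hasFDerivAt_inv_ofReal_fst p hp).mul hW

theorem invFstMulDeriv_fst (p : ℝ × ℝ) (v : ℂ) (D : ℝ × ℝ →L[ℝ] ℂ) :
    invFstMulDeriv p v D (1, 0) = (p.1 : ℂ)⁻¹ * D (1, 0) - v * ((p.1 : ℂ) ^ 2)⁻¹ := by
  simp [invFstMulDeriv, sub_eq_add_neg]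

theorem invFstMulDeriv_snd (p : ℝ × ℝ) (v : ℂ) (D : ℝ × ℝ →L[ℝ] ℂ) :
    invFstMulDeriv p v D (0, 1) = (p.1 : ℂ)⁻¹ * D (0, 1) := by
  simp [invFstMulDeriv]

/-- Green's formula for `∂V` on a disc. -/
theorem setIntegral_disc_wirtinger {V A B : ℂ → ℂ}
    (hV : ∀ w, HasFDerivAt V (wirtingerCLM (A w) (B w)) w) (hA : Continuous A)
    {a : ℝ} (ha : 0 ≤ a) :
    ∫ w in {w : ℂ | 0 < ‖w‖ ∧ ‖w‖ < a}, A w =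
      a / 2 * ∫ θ in (-Real.pi)..Real.pi, polarTwist V (a, θ) := by
  rw [setIntegral_annulus_polar le_rfl ha (by fun_prop)]
  -- With `W` the twisted function, the field `(rW, -iW)` has divergence `2rA`: both the `B` terms
  -- and the undifferentiated `W` cancel.
  have key := integral_divergence_of_periodic (a := 0) (b := a)
    (f := fun p : ℝ × ℝ => (p.1 : ℂ) * polarTwist V p)
    (g := fun p : ℝ × ℝ => -Complex.I * polarTwist V p)
    (f' := fun p => (p.1 : ℂ) • polarTwistDeriv V A B p + polarTwist V p •
        (Complex.ofRealCLM.comp (ContinuousLinearMap.fst ℝ ℝ ℝ)))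
    (g' := fun p => -Complex.I • polarTwistDeriv V A B p)
    (Θ := fun p => 2 * ((p.1 : ℂ) * A (p.1 * Complex.exp (p.2 * Complex.I)))) ha
    (fun p _ => (hasFDerivAt_ofReal_fst p).mul (hasFDerivAt_polarTwist hV p))
    (fun p _ => (hasFDerivAt_polarTwist hV p).const_mul _) ?_ (by fun_prop)
    (fun r => by simp only [polarTwist_pi])
  · simp only [intervalIntegral.integral_const_mul] at key ⊢
    simp at key
    linear_combination key / 2
  · intro p _
    simp [polarTwistDeriv]
    linear_combination (polarTwist V p - p.1 * (A (p.1 * Complex.exp (p.2 * Complex.I)) -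
      B (p.1 * Complex.exp (p.2 * Complex.I)) * Complex.exp (-(p.2 * Complex.I)) ^ 2)) *
      Complex.I_mul_I

/-- Green's formula for `∂̄V / w²` on an annulus. -/
theorem setIntegral_annulus_wirtinger {V A B : ℂ → ℂ}
    (hV : ∀ w, HasFDerivAt V (wirtingerCLM (A w) (B w)) w) (hB : Continuous B)
    {a b : ℝ} (ha : 0 < a) (hab : a ≤ b) :
    ∫ w in {w : ℂ | a < ‖w‖ ∧ ‖w‖ < b}, B w / w ^ 2 =
      1 / (2 * b) * (∫ θ in (-Real.pi)..Real.pi, polarTwist V (b, θ)) -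
        1 / (2 * a) * ∫ θ in (-Real.pi)..Real.pi, polarTwist V (a, θ) := by
  have hne : ∀ p : ℝ × ℝ, a ≤ p.1 → (p.1 : ℂ) ≠ 0 := fun p hp => by
    exact_mod_cast (ha.trans_le hp).ne'
  have hcont : ContinuousOn (fun p : ℝ × ℝ => (p.1 : ℂ) *
      (B (p.1 * Complex.exp (p.2 * Complex.I)) / (p.1 * Complex.exp (p.2 * Complex.I)) ^ 2))
      (Set.Icc a b ×ˢ Set.Icc (-Real.pi) Real.pi) := by
    refine ContinuousOn.mul (by fun_prop) (ContinuousOn.div (by fun_prop) (by fun_prop) ?_)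
    intro p hp
    exact pow_ne_zero _ (mul_ne_zero (hne p hp.1.1) (Complex.exp_ne_zero _))
  rw [setIntegral_annulus_polar (Ψ := fun w => B w / w ^ 2) ha.le hab hcont]
  -- The field `(W/r, iW/r²)` has divergence `2B e^{-2iθ}/r = 2rB/w²`; here it is `A` that cancels.
  have key := integral_divergence_of_periodic (a := a) (b := b)
    (f := fun p : ℝ × ℝ => (p.1 : ℂ)⁻¹ * polarTwist V p)
    (g := fun p : ℝ × ℝ => (p.1 : ℂ)⁻¹ * ((p.1 : ℂ)⁻¹ * (Complex.I * polarTwist V p)))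
    (f' := fun p => invFstMulDeriv p (polarTwist V p) (polarTwistDeriv V A B p))
    (g' := fun p => invFstMulDeriv p ((p.1 : ℂ)⁻¹ * (Complex.I * polarTwist V p))
      (invFstMulDeriv p (Complex.I * polarTwist V p) (Complex.I • polarTwistDeriv V A B p)))
    (Θ := fun p => 2 * ((p.1 : ℂ) * (B (p.1 * Complex.exp (p.2 * Complex.I)) /
          (p.1 * Complex.exp (p.2 * Complex.I)) ^ 2))) hab
    (fun p hp => hasFDerivAt_invFst_mul (hne p hp) (hasFDerivAt_polarTwist hV p))
    (fun p hp => hasFDerivAt_invFst_mul (hne p hp) (hasFDerivAt_invFst_mul (hne p hp)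
      ((hasFDerivAt_polarTwist hV p).const_mul Complex.I))) ?_ (continuousOn_const.mul hcont)
    (fun r => by simp only [polarTwist_pi])
  · simp only [intervalIntegral.integral_const_mul] at key ⊢
    rw [one_div, one_div, mul_inv, mul_inv]
    linear_combination key / 2
  · intro p hp
    have := Complex.exp_ne_zero (p.2 * Complex.I)
    have := hne p hp
    simp only [invFstMulDeriv_fst, invFstMulDeriv_snd]
    simp [polarTwistDeriv, Complex.exp_neg]
    field_simp
    linear_combination (p.1 * (A (p.1 * Complex.exp (p.2 * Complex.I)) *
      Complex.exp (p.2 * Complex.I) ^ 2 - B (p.1 * Complex.exp (p.2 * Complex.I))) -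
      polarTwist V p * Complex.exp (p.2 * Complex.I) ^ 2) *
      Complex.I_mul_I

/-! ### Integrals of powers of the norm -/

theorem integrableOn_fun_norm_iff {T : Set ℝ} (hT : MeasurableSet T) (hT0 : T ⊆ Set.Ioi 0)
    {g : ℝ → ℝ} :
    IntegrableOn (fun w : ℂ => g ‖w‖) {w : ℂ | ‖w‖ ∈ T} ↔ IntegrableOn (fun r => r * g r) T := by
  have hS : MeasurableSet {w : ℂ | ‖w‖ ∈ T} := measurable_norm hT
  rw [← integrable_indicator_iff hS]
  have := integrable_fun_norm_addHaar (E := ℂ) (f := T.indicator g) volume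
  have h1 : (fun w : ℂ => T.indicator g ‖w‖) =
      {w : ℂ | ‖w‖ ∈ T}.indicator (fun w : ℂ => g ‖w‖) := rfl
  rw [← h1, this, Complex.finrank_real_complex, ← integrable_indicator_iff measurableSet_Ioi,
    ← integrable_indicator_iff hT]
  apply iff_of_eq
  congr 1
  ext r
  by_cases h : r ∈ T
  · simp [h, hT0 h]
  · simp [h]

theorem setIntegral_fun_norm {T : Set ℝ} (hT : MeasurableSet T) (hT0 : T ⊆ Set.Ioi 0)
    {g : ℝ → ℝ} :
    ∫ w in {w : ℂ | ‖w‖ ∈ T}, g ‖w‖ = 2 * Real.pi * ∫ r in T, r * g r := by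
  have hS : MeasurableSet {w : ℂ | ‖w‖ ∈ T} := measurable_norm hT
  rw [← integral_indicator hS]
  have := integral_fun_norm_addHaar (E := ℂ) volume (T.indicator g)
  have h1 : (fun w : ℂ => T.indicator g ‖w‖) =
      {w : ℂ | ‖w‖ ∈ T}.indicator (fun w : ℂ => g ‖w‖) := rfl
  rw [← h1, this, Complex.finrank_real_complex]
  have h2 : ∀ r, r ^ (2 - 1) • T.indicator g r = T.indicator (fun r => r * g r) r := by
    intro r
    by_cases h : r ∈ T <;> simp [h]
  simp only [h2]
  rw [setIntegral_indicator hT, Set.inter_eq_self_of_subset_right hT0]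
  simp [Measure.real, Complex.volume_ball]
  ring

theorem integrableOn_norm_rpow_outside {s : ℝ} (hs : s < -2) {a : ℝ} (ha : 0 < a) :
    IntegrableOn (fun w : ℂ => ‖w‖ ^ s) {w : ℂ | a < ‖w‖} := by
  have h := integrableOn_fun_norm_iff (T := Set.Ioi a) measurableSet_Ioi
    (fun x hx => ha.trans hx) (g := fun r => r ^ s)
  refine h.2 ?_
  refine (integrableOn_Ioi_rpow_of_lt (by linarith : s + 1 < -1) ha).congr_fun ?_ measurableSet_Ioi
  intro r hr
  have : 0 < r := ha.trans hr
  simp only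
  rw [Real.rpow_add this, Real.rpow_one, mul_comm]

theorem setIntegral_norm_rpow_outside {s : ℝ} (hs : s < -2) {a : ℝ} (ha : 0 < a) :
    ∫ w in {w : ℂ | a < ‖w‖}, ‖w‖ ^ s = 2 * Real.pi * (-a ^ (s + 2) / (s + 2)) := by
  have h := setIntegral_fun_norm (T := Set.Ioi a) measurableSet_Ioi
    (fun x hx => ha.trans hx) (g := fun r => r ^ s)
  refine h.trans ?_
  have h2 := integral_Ioi_rpow_of_lt (by linarith : s + 1 < -1) ha
  rw [show s + 1 + 1 = s + 2 by ring] at h2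
  rw [← h2]
  congr 1
  refine setIntegral_congr_fun measurableSet_Ioi ?_
  intro r hr
  have : 0 < r := ha.trans hr
  simp only
  rw [Real.rpow_add this, Real.rpow_one, mul_comm]

theorem integrableOn_norm_rpow_punctured {s : ℝ} (hs : -2 < s) {a : ℝ} (ha : 0 ≤ a) :
    IntegrableOn (fun w : ℂ => ‖w‖ ^ s) {w : ℂ | 0 < ‖w‖ ∧ ‖w‖ ≤ a} := by
  have h := integrableOn_fun_norm_iff (T := Set.Ioc 0 a) measurableSet_Ioc
    (fun x hx => hx.1) (g := fun r => r ^ s)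
  refine h.2 ?_
  have := intervalIntegral.intervalIntegrable_rpow' (a := 0) (b := a) (by linarith : -1 < s + 1)
  rw [intervalIntegrable_iff_integrableOn_Ioc_of_le ha] at this
  refine this.congr_fun ?_ measurableSet_Ioc
  intro r hr
  simp only
  rw [Real.rpow_add hr.1, Real.rpow_one, mul_comm]

theorem setIntegral_norm_rpow_punctured {s : ℝ} (hs : -2 < s) {a : ℝ} (ha : 0 ≤ a) :
    ∫ w in {w : ℂ | 0 < ‖w‖ ∧ ‖w‖ ≤ a}, ‖w‖ ^ s = 2 * Real.pi * (a ^ (s + 2) / (s + 2)) := by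
  have h := setIntegral_fun_norm (T := Set.Ioc 0 a) measurableSet_Ioc
    (fun x hx => hx.1) (g := fun r => r ^ s)
  refine h.trans ?_
  have h2 := integral_rpow (a := 0) (b := a) (r := s + 1) (Or.inl (by linarith))
  rw [show s + 1 + 1 = s + 2 by ring, Real.zero_rpow (by linarith), sub_zero,
    intervalIntegral.integral_of_le ha] at h2
  rw [← h2]
  congr 1
  refine setIntegral_congr_fun measurableSet_Ioc ?_
  intro r hr
  simp only
  rw [Real.rpow_add hr.1, Real.rpow_one, mul_comm]

/-! ### Regularised kernels -/

/-- A smooth regularisation of the kernel `1 / (π conj u)`. -/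
noncomputable def cauchyReg (δ : ℝ) (u : ℂ) : ℂ := u / (Real.pi * (u * conj u + δ ^ 2))

/-- The `∂̄`-derivative of `cauchyReg δ`; a smooth regularisation of the conjugate of the Beurling
kernel. -/
noncomputable def kernelReg (δ : ℝ) (u : ℂ) : ℂ :=
  -u ^ 2 / (Real.pi * (u * conj u + δ ^ 2) ^ 2)

/-- The `∂`-derivative of `cauchyReg δ`; an approximate identity. -/
noncomputable def approxId (δ : ℝ) (u : ℂ) : ℝ := δ ^ 2 / (Real.pi * (‖u‖ ^ 2 + δ ^ 2) ^ 2)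

theorem mul_conj_add_sq (δ : ℝ) (u : ℂ) :
    u * conj u + (δ : ℂ) ^ 2 = ((‖u‖ ^ 2 + δ ^ 2 : ℝ) : ℂ) := by
  rw [Complex.mul_conj, Complex.normSq_eq_norm_sq]
  push_cast
  ring

theorem mul_conj_add_sq_ne_zero {δ : ℝ} (hδ : 0 < δ) (u : ℂ) :
    u * conj u + (δ : ℂ) ^ 2 ≠ 0 := by
  rw [mul_conj_add_sq]
  have : 0 < ‖u‖ ^ 2 + δ ^ 2 := by positivity
  exact_mod_cast this.ne'

theorem ofReal_pi_ne_zero : (Real.pi : ℂ) ≠ 0 := by exact_mod_cast Real.pi_ne_zero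

theorem ofReal_approxId (δ : ℝ) (u : ℂ) :
    (approxId δ u : ℂ) = (δ : ℂ) ^ 2 / (Real.pi * (u * conj u + δ ^ 2) ^ 2) := by
  rw [mul_conj_add_sq, approxId]
  push_cast
  rfl

/-- Quotient rule, with `u` and `conj u` treated as independent: in `∂` the terms `u conj u` cancel
and leave `δ²`. One potential for both kernels is what lets Green's formulas compare them. -/
theorem hasFDerivAt_cauchyReg {δ : ℝ} (hδ : 0 < δ) (u : ℂ) :
    HasFDerivAt (cauchyReg δ) (wirtingerCLM (approxId δ u) (kernelReg δ u)) u := by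
  have hid : HasFDerivAt (fun u : ℂ => u) (ContinuousLinearMap.id ℝ ℂ) u := hasFDerivAt_id u
  have hcj : HasFDerivAt (fun u : ℂ => conj u) (Complex.conjCLE : ℂ →L[ℝ] ℂ) u :=
    Complex.conjCLE.hasFDerivAt
  have hne : (Real.pi : ℂ) * (u * conj u + δ ^ 2) ≠ 0 :=
    mul_ne_zero ofReal_pi_ne_zero (mul_conj_add_sq_ne_zero hδ u)
  have h := hid.mul ((hasDerivAt_inv hne).comp_hasFDerivAt u
    (((hid.mul hcj).add_const ((δ : ℂ) ^ 2)).const_mul (Real.pi : ℂ)))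
  refine HasFDerivAt.congr_fderiv (h.congr_of_eventuallyEq (.of_forall fun v => ?_)) ?_
  · simp [cauchyReg, div_eq_mul_inv]
  · refine ContinuousLinearMap.ext fun h => ?_
    rw [wirtingerCLM_apply, ofReal_approxId, kernelReg]
    have h1 := ofReal_pi_ne_zero
    have h2 := mul_conj_add_sq_ne_zero hδ u
    simp
    field_simp
    ring

theorem norm_kernelReg_eq (δ : ℝ) (u : ℂ) :
    ‖kernelReg δ u‖ = ‖u‖ ^ 2 / (Real.pi * (‖u‖ ^ 2 + δ ^ 2) ^ 2) := by
  rw [kernelReg, mul_conj_add_sq]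
  simp only [norm_div, norm_neg, norm_pow, norm_mul, Complex.norm_real, Real.norm_eq_abs]
  rw [abs_of_pos Real.pi_pos, abs_of_nonneg (by positivity : 0 ≤ ‖u‖ ^ 2 + δ ^ 2)]

theorem norm_kernelReg_le {δ : ℝ} (hδ : 0 < δ) (u : ℂ) :
    ‖kernelReg δ u‖ ≤ 1 / (Real.pi * (‖u‖ ^ 2 + δ ^ 2)) := by
  rw [norm_kernelReg_eq, div_le_div_iff₀ (by positivity) (by positivity)]
  have : ‖u‖ ^ 2 ≤ ‖u‖ ^ 2 + δ ^ 2 := by nlinarith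
  calc _ ≤ (‖u‖ ^ 2 + δ ^ 2) * (Real.pi * (‖u‖ ^ 2 + δ ^ 2)) := by gcongr
    _ = _ := by ring

/-- The bound does not depend on `δ` and covers `δ = 0`, so it dominates every limit `δ → 0` taken
away from the singularity. -/
theorem norm_kernelReg_le_inv_sq (δ : ℝ) (u : ℂ) :
    ‖kernelReg δ u‖ ≤ 1 / (Real.pi * ‖u‖ ^ 2) := by
  rcases eq_or_ne u 0 with rfl | hu
  · simp [kernelReg]
  have hu' : 0 < ‖u‖ := norm_pos_iff.2 hu
  rw [norm_kernelReg_eq, div_le_div_iff₀ (by positivity) (by positivity), one_mul,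
    mul_left_comm]
  gcongr
  nlinarith [sq_nonneg δ, sq_nonneg ‖u‖, sq_nonneg (‖u‖ * δ), sq_nonneg (δ ^ 2)]

theorem norm_cauchyReg_le {δ : ℝ} (hδ : 0 < δ) (u : ℂ) :
    ‖cauchyReg δ u‖ ≤ 1 / (Real.pi * δ) := by
  rw [cauchyReg, mul_conj_add_sq]
  simp only [norm_div, norm_mul, Complex.norm_real, Real.norm_eq_abs]
  rw [abs_of_pos Real.pi_pos, abs_of_nonneg (by positivity : 0 ≤ ‖u‖ ^ 2 + δ ^ 2),
    div_le_div_iff₀ (by positivity) (by positivity), one_mul, mul_left_comm]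
  gcongr
  nlinarith [sq_nonneg (‖u‖ - δ), norm_nonneg u]

theorem continuous_kernelReg {δ : ℝ} (hδ : 0 < δ) : Continuous (kernelReg δ) := by
  unfold kernelReg
  refine Continuous.div (by fun_prop) (by fun_prop) fun u => ?_
  exact mul_ne_zero ofReal_pi_ne_zero (pow_ne_zero _ (mul_conj_add_sq_ne_zero hδ u))

theorem continuous_approxId {δ : ℝ} (hδ : 0 < δ) : Continuous (approxId δ) := by
  unfold approxId
  refine Continuous.div (by fun_prop) (by fun_prop) fun u => ?_
  positivity

theorem kernelReg_neg (δ : ℝ) (u : ℂ) : kernelReg δ (-u) = kernelReg δ u := by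
  simp [kernelReg]

/-- A quarter turn changes the sign of `u²` and keeps `|u|`. This antisymmetry is the source of all
cancellation over radial sets. -/
theorem kernelReg_I_mul (δ : ℝ) (u : ℂ) : kernelReg δ (Complex.I * u) = -kernelReg δ u := by
  have : Complex.I * u * conj (Complex.I * u) = u * conj u := by
    simp only [map_mul, Complex.conj_I]
    linear_combination (-u * conj u) * Complex.I_mul_I
  simp only [kernelReg, this, mul_pow, Complex.I_sq]
  ring

theorem conj_beurlingKernel_eq (u : ℂ) : conj (beurlingKernel u) = kernelReg 0 u := by
  rcases eq_or_ne u 0 with rfl | hu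
  · simp [beurlingKernel, kernelReg]
  have hu' : conj u ≠ 0 := (map_ne_zero _).2 hu
  simp only [beurlingKernel, kernelReg, map_div₀, map_neg, map_one, map_mul, map_pow,
    Complex.conj_ofReal]
  have := ofReal_pi_ne_zero
  field_simp
  simp [mul_pow, mul_comm]

theorem tendsto_kernelReg (u : ℂ) :
    Tendsto (fun δ : ℝ => kernelReg δ u) (𝓝[>] 0) (𝓝 (conj (beurlingKernel u))) := by
  rw [conj_beurlingKernel_eq]
  rcases eq_or_ne u 0 with rfl | hu
  · simp [kernelReg]
  have hu' : conj u ≠ 0 := (map_ne_zero _).2 hu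
  refine tendsto_nhdsWithin_of_tendsto_nhds (ContinuousAt.tendsto ?_)
  unfold kernelReg
  refine ContinuousAt.div (by fun_prop) (by fun_prop) ?_
  simpa [ofReal_pi_ne_zero] using hu

theorem norm_beurlingKernel (w : ℂ) : ‖beurlingKernel w‖ = 1 / (Real.pi * ‖w‖ ^ 2) := by
  simp [beurlingKernel, abs_of_pos Real.pi_pos]

/-- For fixed `δ`, translates by bounded `y` decay like `|w|⁻²` uniformly. Multiplied by the
Beurling kernel this gives `|w|⁻⁴`, integrable at infinity, as the later use of Fubini requires. -/
theorem norm_sq_mul_norm_kernelReg_le {δ M : ℝ} (hδ : 0 < δ) {w y : ℂ} (hy : ‖y‖ ≤ M) :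
    ‖w‖ ^ 2 * ‖kernelReg δ (w - y)‖ ≤ 2 * (1 + M ^ 2 / δ ^ 2) / Real.pi := by
  have h1 : ‖w‖ ^ 2 ≤ 2 * (1 + M ^ 2 / δ ^ 2) * (‖w - y‖ ^ 2 + δ ^ 2) := by
    have h2 : ‖w‖ ≤ ‖w - y‖ + ‖y‖ := by simpa using norm_add_le (w - y) y
    have h3 : ‖w‖ ^ 2 ≤ 2 * ‖w - y‖ ^ 2 + 2 * M ^ 2 := by
      have : ‖w‖ ^ 2 ≤ (‖w - y‖ + M) ^ 2 := by gcongr; linarith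
      nlinarith [sq_nonneg (‖w - y‖ - M)]
    have h4 : 2 * (1 + M ^ 2 / δ ^ 2) * (‖w - y‖ ^ 2 + δ ^ 2) =
      2 * ‖w - y‖ ^ 2 + 2 * M ^ 2 + 2 * δ ^ 2 + 2 * (M ^ 2 / δ ^ 2) * ‖w - y‖ ^ 2 := by
      field_simp
      ring
    have : 0 ≤ 2 * δ ^ 2 + 2 * (M ^ 2 / δ ^ 2) * ‖w - y‖ ^ 2 := by positivity
    linarith
  calc ‖w‖ ^ 2 * ‖kernelReg δ (w - y)‖
      ≤ (2 * (1 + M ^ 2 / δ ^ 2) * (‖w - y‖ ^ 2 + δ ^ 2)) *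
        (1 / (Real.pi * (‖w - y‖ ^ 2 + δ ^ 2))) := by
        gcongr
        exact norm_kernelReg_le hδ _
    _ = _ := by
        have : ‖w - y‖ ^ 2 + δ ^ 2 ≠ 0 := by positivity
        field_simp

theorem measurable_beurlingKernel : Measurable beurlingKernel := by
  unfold beurlingKernel
  fun_prop

theorem measurableSet_lt_norm (a : ℝ) : MeasurableSet {w : ℂ | a < ‖w‖} :=
  measurableSet_lt measurable_const measurable_norm

theorem norm_kernelReg_mul_beurlingKernel_le {δ M a : ℝ} (hδ : 0 < δ) (ha : 0 < a) {w y : ℂ}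
    (hy : ‖y‖ ≤ M) (hw : a < ‖w‖) :
    ‖kernelReg δ (w - y) * beurlingKernel w‖ ≤
      2 * (1 + M ^ 2 / δ ^ 2) / Real.pi ^ 2 * ‖w‖ ^ (-4 : ℝ) := by
  have hw0 : 0 < ‖w‖ := ha.trans hw
  have h := norm_sq_mul_norm_kernelReg_le hδ hy (w := w)
  have h5 : ‖kernelReg δ (w - y)‖ ≤ 2 * (1 + M ^ 2 / δ ^ 2) / Real.pi / ‖w‖ ^ 2 := by
    rw [le_div_iff₀ (by positivity), mul_comm]
    exact h
  rw [norm_mul, norm_beurlingKernel, Real.rpow_neg hw0.le,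
    show ‖w‖ ^ (4 : ℝ) = ‖w‖ ^ 4 by exact_mod_cast Real.rpow_natCast ‖w‖ 4]
  calc _ ≤ 2 * (1 + M ^ 2 / δ ^ 2) / Real.pi / ‖w‖ ^ 2 * (1 / (Real.pi * ‖w‖ ^ 2)) := by gcongr
    _ = _ := by field_simp

theorem integrableOn_kernelReg_mul_beurlingKernel {δ a : ℝ} (hδ : 0 < δ) (ha : 0 < a) (y : ℂ) :
    IntegrableOn (fun w => kernelReg δ (w - y) * beurlingKernel w) {w : ℂ | a < ‖w‖} := by
  refine Integrable.mono' ((integrableOn_norm_rpow_outside (s := -4) (by norm_num) ha).const_mul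
    (2 * (1 + ‖y‖ ^ 2 / δ ^ 2) / Real.pi ^ 2)) ?_ ?_
  · exact (((continuous_kernelReg hδ).measurable.comp (measurable_id.sub_const y)).mul
      measurable_beurlingKernel).aestronglyMeasurable
  · filter_upwards [ae_restrict_mem (measurableSet_lt_norm a)] with w hw
    exact norm_kernelReg_mul_beurlingKernel_le hδ ha le_rfl hw

theorem norm_polarTwist_le {V : ℂ → ℂ} {M : ℝ} (hV : ∀ w, ‖V w‖ ≤ M) (p : ℝ × ℝ) :
    ‖polarTwist V p‖ ≤ M := by
  have : ‖Complex.exp (-(p.2 * Complex.I))‖ = 1 := by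
    have := Complex.norm_exp_ofReal_mul_I (-p.2)
    simpa using this
  rw [polarTwist, norm_mul, this, mul_one]
  exact hV _

theorem setIntegral_ball_eq_punctured (F : ℂ → ℂ) (a : ℝ) :
    ∫ w in {w : ℂ | 0 < ‖w‖ ∧ ‖w‖ < a}, F w = ∫ w in Metric.ball (0 : ℂ) a, F w := by
  have : {w : ℂ | 0 < ‖w‖ ∧ ‖w‖ < a} = Metric.ball (0 : ℂ) a \ {0} := by
    ext w
    simp [and_comm]
  rw [this]
  exact setIntegral_congr_set (sdiff_null_ae_eq_self (by simp))

/-- The truncated Beurling transform of a translate of `kernelReg δ` is an average of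
`approxId δ`. -/
theorem setIntegral_kernelReg_mul_beurlingKernel {δ a : ℝ} (hδ : 0 < δ) (ha : 0 < a) (y : ℂ) :
    ∫ w in {w : ℂ | a < ‖w‖}, kernelReg δ (w - y) * beurlingKernel w =
      1 / (Real.pi * a ^ 2) * ∫ w in Metric.ball (0 : ℂ) a, (approxId δ (w - y) : ℂ) := by
  have hV : ∀ w, HasFDerivAt (fun w => cauchyReg δ (w - y))
      (wirtingerCLM (approxId δ (w - y)) (kernelReg δ (w - y))) w := fun w =>
    HasFDerivAt.comp (f := fun w => w - y) w (hasFDerivAt_cauchyReg hδ (w - y))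
      ((hasFDerivAt_id w).sub_const y)
  have hA : Continuous fun w => (approxId δ (w - y) : ℂ) :=
    Complex.continuous_ofReal.comp ((continuous_approxId hδ).comp (continuous_sub_right y))
  have hB : Continuous fun w => kernelReg δ (w - y) :=
    (continuous_kernelReg hδ).comp (continuous_sub_right y)
  set W := polarTwist (fun w => cauchyReg δ (w - y)) with hW
  have hdisc := setIntegral_disc_wirtinger hV hA ha.le
  have hann : ∀ n : ℕ, a ≤ n → ∫ w in {w : ℂ | a < ‖w‖ ∧ ‖w‖ < n},
      kernelReg δ (w - y) * beurlingKernel w =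
      -(1 / Real.pi) * (1 / (2 * n) * (∫ θ in (-Real.pi)..Real.pi, W (n, θ)) -
        1 / (2 * a) * ∫ θ in (-Real.pi)..Real.pi, W (a, θ)) := by
    intro n hn
    have := setIntegral_annulus_wirtinger hV hB ha hn
    rw [Complex.ofReal_natCast] at this
    rw [← this, ← integral_const_mul]
    congr 1
    ext w
    simp only [beurlingKernel, div_eq_mul_inv, mul_inv]
    ring
  have hlim1 : Tendsto (fun n : ℕ => ∫ w in {w : ℂ | a < ‖w‖ ∧ ‖w‖ < n},
      kernelReg δ (w - y) * beurlingKernel w) atTop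
      (𝓝 (∫ w in {w : ℂ | a < ‖w‖}, kernelReg δ (w - y) * beurlingKernel w)) := by
    have hU : {w : ℂ | a < ‖w‖} = ⋃ n : ℕ, {w : ℂ | a < ‖w‖ ∧ ‖w‖ < n} := by
      ext w
      simp only [Set.mem_ofPred_eq, Set.mem_iUnion]
      exact ⟨fun h => (exists_nat_gt ‖w‖).imp fun n hn => ⟨h, hn⟩, fun ⟨n, h, _⟩ => h⟩
    rw [hU]
    refine tendsto_setIntegral_of_monotone (fun n => ?_) ?_ ?_
    · exact (measurableSet_lt_norm a).inter (measurableSet_lt measurable_norm measurable_const)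
    · intro m n hmn w hw
      exact ⟨hw.1, hw.2.trans_le (by exact_mod_cast hmn)⟩
    · rw [← hU]
      exact integrableOn_kernelReg_mul_beurlingKernel hδ ha y
  -- The outer boundary term disappears because the potential is bounded by `1/(πδ)`.
  have hlim2 : Tendsto (fun n : ℕ => 1 / (2 * (n : ℂ)) * ∫ θ in (-Real.pi)..Real.pi, W (n, θ))
      atTop (𝓝 0) := by
    have hM : ∀ n : ℕ, ‖∫ θ in (-Real.pi)..Real.pi, W (n, θ)‖ ≤
        1 / (Real.pi * δ) * |Real.pi - -Real.pi| := fun n =>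
      intervalIntegral.norm_integral_le_of_norm_le_const fun θ _ =>
        norm_polarTwist_le (fun w => norm_cauchyReg_le hδ (w - y)) _
    refine squeeze_zero_norm (a := fun n : ℕ => (1 / 2 * (1 / (Real.pi * δ) *
      |Real.pi - -Real.pi|)) / n) (fun n => ?_) (tendsto_const_div_atTop_nhds_zero_nat _)
    rw [norm_mul]
    have : ‖1 / (2 * (n : ℂ))‖ = 1 / 2 * (1 / n) := by simp; ring
    rw [this]
    calc _ ≤ 1 / 2 * (1 / (n : ℝ)) * (1 / (Real.pi * δ) * |Real.pi - -Real.pi|) := by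
          gcongr
          exact hM n
      _ = _ := by ring
  have hlim3 : Tendsto (fun n : ℕ => ∫ w in {w : ℂ | a < ‖w‖ ∧ ‖w‖ < n},
      kernelReg δ (w - y) * beurlingKernel w) atTop
      (𝓝 (-(1 / Real.pi) * (0 - 1 / (2 * a) * ∫ θ in (-Real.pi)..Real.pi, W (a, θ)))) := by
    refine ((hlim2.sub_const _).const_mul _).congr' ?_
    filter_upwards [eventually_ge_atTop ⌈a⌉₊] with n hn
    exact (hann n (Nat.ceil_le.1 hn)).symm
  -- Only the integral over the circle of radius `a` survives, and the disc formula expresses it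
  -- through `approxId`.
  rw [tendsto_nhds_unique hlim1 hlim3, ← setIntegral_ball_eq_punctured, hdisc]
  have : (a : ℂ) ≠ 0 := by exact_mod_cast ha.ne'
  have := ofReal_pi_ne_zero
  field_simp
  simp [hW]

/-- Green's formula turns the mass into a circle integral of the twisted potential, which is
constant on circles centred at the origin. -/
theorem setIntegral_ball_approxId {δ a : ℝ} (hδ : 0 < δ) (ha : 0 < a) :
    ∫ w in Metric.ball (0 : ℂ) a, (approxId δ w : ℂ) = ((a ^ 2 / (a ^ 2 + δ ^ 2) : ℝ) : ℂ) := by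
  rw [← setIntegral_ball_eq_punctured, setIntegral_disc_wirtinger (hasFDerivAt_cauchyReg hδ)
    (Complex.continuous_ofReal.comp (continuous_approxId hδ)) ha.le]
  have h : ∀ θ : ℝ, polarTwist (cauchyReg δ) (a, θ) =
      ((a / (Real.pi * (a ^ 2 + δ ^ 2)) : ℝ) : ℂ) := by
    intro θ
    rw [polarTwist, cauchyReg, mul_conj_add_sq, norm_mul, Complex.norm_exp_ofReal_mul_I,
      Complex.norm_real, Real.norm_eq_abs, mul_one, sq_abs, div_mul_eq_mul_div, mul_assoc,
      ← Complex.exp_add]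
    simp
  simp only [h, intervalIntegral.integral_const]
  have h2 : a ^ 2 + δ ^ 2 ≠ 0 := by positivity
  have := Real.pi_ne_zero
  rw [Complex.real_smul, ← Complex.ofReal_mul]
  rw [show (a : ℂ) / 2 = ((a / 2 : ℝ) : ℂ) by push_cast; rfl, ← Complex.ofReal_mul]
  congr 1
  field_simp
  ring

/-! ### The square -/

/-- The square `[-1, 1]²`. -/
noncomputable def unitSquare : Set ℂ := axisSquare 0 2

theorem mem_unitSquare {w : ℂ} : w ∈ unitSquare ↔ |w.re| ≤ 1 ∧ |w.im| ≤ 1 := by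
  simp [unitSquare, axisSquare]

theorem isClosed_unitSquare : IsClosed unitSquare := by
  have : unitSquare = {w : ℂ | |w.re| ≤ 1} ∩ {w : ℂ | |w.im| ≤ 1} := by
    ext w
    simp [mem_unitSquare]
  rw [this]
  exact (isClosed_le (by fun_prop) continuous_const).inter
    (isClosed_le (by fun_prop) continuous_const)

theorem measurableSet_unitSquare : MeasurableSet unitSquare := isClosed_unitSquare.measurableSet

theorem norm_le_of_mem_unitSquare {w : ℂ} (hw : w ∈ unitSquare) : ‖w‖ ≤ 3 / 2 := by
  rw [mem_unitSquare] at hw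
  have h := Complex.normSq_eq_norm_sq w
  rw [Complex.normSq_apply] at h
  have h1 := sq_abs w.re
  have h2 := sq_abs w.im
  nlinarith [abs_nonneg w.re, abs_nonneg w.im, norm_nonneg w]

theorem volume_unitSquare : volume unitSquare = 4 := by
  have h := Complex.volume_preserving_equiv_real_prod
  have h1 : unitSquare = Complex.measurableEquivRealProd ⁻¹'
      (Set.Icc (-1 : ℝ) 1 ×ˢ Set.Icc (-1 : ℝ) 1) := by
    ext w
    simp only [mem_unitSquare, abs_le, Set.mem_preimage, Set.mem_prod, Set.mem_Icc,
      Complex.measurableEquivRealProd_apply]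
  rw [h1, h.measure_preimage_equiv, Measure.volume_eq_prod, Measure.prod_prod, Real.volume_Icc,
    ← ENNReal.ofReal_mul (by norm_num)]
  norm_num

theorem volume_unitSquare_lt_top : volume unitSquare < ∞ := by
  rw [volume_unitSquare]
  exact ENNReal.ofNat_lt_top

/-- The indicator function of `[-1, 1]²`. -/
noncomputable def squareInd : ℂ → ℂ := unitSquare.indicator fun _ => 1

theorem measurable_squareInd : Measurable squareInd :=
  measurable_const.indicator measurableSet_unitSquare

/-- The distance to the union of the four lines that carry the sides of `[-1, 1]²`. -/
noncomputable def edgeDist (z : ℂ) : ℝ := min |(|z.re| - 1)| |(|z.im| - 1)|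

theorem continuous_edgeDist : Continuous edgeDist := by
  unfold edgeDist
  fun_prop

theorem edgeDist_nonneg (z : ℂ) : 0 ≤ edgeDist z := le_min (abs_nonneg _) (abs_nonneg _)

theorem abs_sub_le_iff_of_lt {x y : ℝ} (h : |y| < |(|x| - 1)|) : |x - y| ≤ 1 ↔ |x| ≤ 1 := by
  have h1 := abs_abs_sub_abs_le x (x - y)
  rw [sub_sub_cancel] at h1
  rcases abs_cases (|x| - 1) with h2 | h2 <;> rcases abs_cases (|x| - |x - y|) with h3 | h3 <;>
    constructor <;> intro h4 <;> linarith

theorem sub_mem_unitSquare_iff {z w : ℂ} (h : ‖w‖ < edgeDist z) :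
    z - w ∈ unitSquare ↔ z ∈ unitSquare := by
  rw [mem_unitSquare, mem_unitSquare, Complex.sub_re, Complex.sub_im,
    abs_sub_le_iff_of_lt ((Complex.abs_re_le_norm w).trans_lt (h.trans_le (min_le_left _ _))),
    abs_sub_le_iff_of_lt ((Complex.abs_im_le_norm w).trans_lt (h.trans_le (min_le_right _ _)))]

theorem squareInd_sub {z w : ℂ} (h : ‖w‖ < edgeDist z) : squareInd (z - w) = squareInd z := by
  have := sub_mem_unitSquare_iff h
  by_cases hz : z ∈ unitSquare
  · rw [squareInd, Set.indicator_of_mem hz, Set.indicator_of_mem (this.2 hz)]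
  · rw [squareInd, Set.indicator_of_notMem hz, Set.indicator_of_notMem (fun h => hz (this.1 h))]

theorem quasiMeasurePreserving_re : Measure.QuasiMeasurePreserving Complex.re volume volume :=
  Measure.quasiMeasurePreserving_fst.comp
    Complex.volume_preserving_equiv_real_prod.quasiMeasurePreserving

theorem quasiMeasurePreserving_im : Measure.QuasiMeasurePreserving Complex.im volume volume :=
  Measure.quasiMeasurePreserving_snd.comp
    Complex.volume_preserving_equiv_real_prod.quasiMeasurePreserving

theorem ae_edgeDist_pos : ∀ᵐ z : ℂ, 0 < edgeDist z := by
  have h : ∀ᵐ x : ℝ, 0 < |(|x| - 1)| := by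
    have : ∀ᵐ x : ℝ, x ∉ ({1, -1} : Set ℝ) :=
      (Set.toFinite ({1, -1} : Set ℝ)).countable.ae_notMem _
    filter_upwards [this] with x hx
    rw [abs_pos, sub_ne_zero]
    contrapose! hx
    rcases eq_or_eq_neg_of_abs_eq hx with h | h <;> simp [h]
  filter_upwards [quasiMeasurePreserving_re.ae h, quasiMeasurePreserving_im.ae h] with z h1 h2
  exact lt_min h1 h2

/-! ### Transforms of the square by the regularised kernels -/

/-- Rotation by `i` preserves Lebesgue measure and the radial set, so the integral equals its own
negative. The change of variables needs no integrability. -/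
theorem setIntegral_eq_zero_of_I_mul {T : Set ℝ} (hT : MeasurableSet T) {F : ℂ → ℂ}
    (hF : ∀ u, F (Complex.I * u) = -F u) : ∫ u in {u : ℂ | ‖u‖ ∈ T}, F u = 0 := by
  have hS : MeasurableSet {w : ℂ | ‖w‖ ∈ T} := measurable_norm hT
  rw [← integral_indicator hS]
  set H := {w : ℂ | ‖w‖ ∈ T}.indicator F with hH
  have h1 : ∀ u, H (Complex.I * u) = -H u := by
    intro u
    by_cases h : ‖u‖ ∈ T
    · rw [hH, Set.indicator_of_mem (by simpa using h), Set.indicator_of_mem (by simpa using h), hF]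
    · rw [hH, Set.indicator_of_notMem (by simpa using h), Set.indicator_of_notMem
        (by simpa using h), neg_zero]
  let R : ℂ ≃ₗᵢ[ℝ] ℂ := rotation ⟨Complex.I, by simp [Submonoid.unitSphere]⟩
  have hR : ∀ u, R u = Complex.I * u := fun u => rotation_apply _ _
  have h2 : ∫ u, H (R u) = ∫ u, H u :=
    R.measurePreserving.integral_comp R.toHomeomorph.measurableEmbedding H
  simp only [hR, h1, integral_neg] at h2
  have h3 : (2 : ℂ) * ∫ u, H u = 0 := by linear_combination -h2
  simpa using h3

theorem measurable_kernelReg (δ : ℝ) : Measurable (kernelReg δ) := by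
  unfold kernelReg
  have : Measurable fun u : ℂ => conj u := Complex.continuous_conj.measurable
  fun_prop

/-- The integrals defining the transforms of the square may be restricted to `edgeDist z ≤ ‖w‖`. -/
theorem setIntegral_squareInd_mul_kernelReg {δ : ℝ} {T : Set ℝ} (hT : MeasurableSet T) {z : ℂ}
    (hi : IntegrableOn (fun w => squareInd (z - w) * kernelReg δ w) {w : ℂ | ‖w‖ ∈ T}) :
    ∫ w in {w : ℂ | ‖w‖ ∈ T}, squareInd (z - w) * kernelReg δ w =
      ∫ w in {w : ℂ | ‖w‖ ∈ T ∧ edgeDist z ≤ ‖w‖}, squareInd (z - w) * kernelReg δ w := by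
  have hD : MeasurableSet {w : ℂ | ‖w‖ ∈ Set.Iio (edgeDist z)} :=
    measurable_norm measurableSet_Iio
  rw [← integral_inter_add_sdiff hD hi]
  have h1 : ∫ w in {w : ℂ | ‖w‖ ∈ T} ∩ {w : ℂ | ‖w‖ ∈ Set.Iio (edgeDist z)},
      squareInd (z - w) * kernelReg δ w = 0 := by
    have hS : {w : ℂ | ‖w‖ ∈ T} ∩ {w : ℂ | ‖w‖ ∈ Set.Iio (edgeDist z)} =
      {w : ℂ | ‖w‖ ∈ T ∩ Set.Iio (edgeDist z)} := rfl
    rw [hS]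
    have hm := hT.inter (measurableSet_Iio (a := edgeDist z))
    rw [setIntegral_congr_fun (g := fun w => squareInd z * kernelReg δ w)
      (show MeasurableSet {w : ℂ | ‖w‖ ∈ T ∩ Set.Iio (edgeDist z)} from measurable_norm hm)]
    · exact setIntegral_eq_zero_of_I_mul hm fun u => by rw [kernelReg_I_mul]; ring
    · intro w hw
      simp only
      rw [squareInd_sub hw.2]
  rw [h1, zero_add]
  congr 2
  ext w
  simp

theorem norm_squareInd_mul_kernelReg_le {δ : ℝ} {z w : ℂ} :
    ‖squareInd (z - w) * kernelReg δ w‖ ≤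
      unitSquare.indicator (fun _ => (1 : ℝ)) (z - w) * (1 / (Real.pi * ‖w‖ ^ 2)) := by
  rw [norm_mul]
  by_cases h : z - w ∈ unitSquare
  · simp only [squareInd, Set.indicator_of_mem h, norm_one, one_mul]
    exact norm_kernelReg_le_inv_sq δ w
  · simp [squareInd, Set.indicator_of_notMem h]

theorem integrable_indicator_unitSquare_sub (z : ℂ) :
    Integrable fun w => unitSquare.indicator (fun _ => (1 : ℝ)) (z - w) := by
  have : Integrable (unitSquare.indicator (fun _ => (1 : ℝ))) :=
    (integrable_indicator_iff measurableSet_unitSquare).2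
      (integrableOn_const volume_unitSquare_lt_top.ne)
  exact this.comp_sub_left z

theorem integral_indicator_unitSquare_sub (z : ℂ) :
    ∫ w, unitSquare.indicator (fun _ => (1 : ℝ)) (z - w) = 4 := by
  rw [integral_sub_left_eq_self (unitSquare.indicator (fun _ => (1 : ℝ))) volume z,
    integral_indicator measurableSet_unitSquare]
  simp [Measure.real, volume_unitSquare]

theorem aestronglyMeasurable_squareInd_mul_kernelReg (δ : ℝ) (z : ℂ) (μ : Measure ℂ) :
    AEStronglyMeasurable (fun w => squareInd (z - w) * kernelReg δ w) μ :=
  ((measurable_squareInd.comp (measurable_id.const_sub z)).mul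
    (measurable_kernelReg δ)).aestronglyMeasurable

theorem integrableOn_squareInd_mul_kernelReg {δ a : ℝ} (ha : 0 < a) (z : ℂ) {S : Set ℂ}
    (hS : MeasurableSet S) (hSa : ∀ w ∈ S, a ≤ ‖w‖) :
    IntegrableOn (fun w => squareInd (z - w) * kernelReg δ w) S := by
  refine Integrable.mono' ((integrable_indicator_unitSquare_sub z).mul_const
    (1 / (Real.pi * a ^ 2))).integrableOn
    (aestronglyMeasurable_squareInd_mul_kernelReg δ z _) ?_
  filter_upwards [ae_restrict_mem hS] with w hw
  refine norm_squareInd_mul_kernelReg_le.trans ?_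
  have := hSa w hw
  gcongr
  exact Set.indicator_nonneg (fun _ _ => zero_le_one) _

theorem integrable_squareInd_mul_kernelReg {δ : ℝ} (hδ : 0 < δ) (z : ℂ) :
    Integrable (fun w => squareInd (z - w) * kernelReg δ w) := by
  refine Integrable.mono' ((integrable_indicator_unitSquare_sub z).mul_const
    (1 / (Real.pi * δ ^ 2)))
    (aestronglyMeasurable_squareInd_mul_kernelReg δ z _) (.of_forall fun w => ?_)
  rw [norm_mul]
  have h1 : ‖kernelReg δ w‖ ≤ 1 / (Real.pi * δ ^ 2) := by
    refine (norm_kernelReg_le hδ w).trans ?_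
    gcongr
    nlinarith [norm_nonneg w]
  refine mul_le_mul ?_ h1 (norm_nonneg _) (Set.indicator_nonneg (fun _ _ => zero_le_one) _)
  by_cases h : z - w ∈ unitSquare <;> simp [squareInd, h]

/-- The transform of the square by `kernelReg δ`, with the part of the integral that cancels
left out. -/
noncomputable def squareTransform (δ : ℝ) (z : ℂ) : ℂ :=
  ∫ w in {w : ℂ | edgeDist z ≤ ‖w‖}, squareInd (z - w) * kernelReg δ w

theorem integral_squareInd_mul_kernelReg {δ : ℝ} (hδ : 0 < δ) (z : ℂ) :
    ∫ w, squareInd (z - w) * kernelReg δ w = squareTransform δ z := by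
  have := setIntegral_squareInd_mul_kernelReg MeasurableSet.univ
    (integrable_squareInd_mul_kernelReg hδ z).integrableOn
  simpa [squareTransform] using this

/-- For `|w| < edgeDist z` the factor `χ(z - w)` is constant and the kernel cancels, so the
truncation no longer depends on `ε`; the principal value is an eventually constant limit. -/
theorem discTruncation_squareInd {ε : ℝ} (hε : 0 < ε) {z : ℂ} (h : ε < edgeDist z) :
    discTruncation (fun w => conj (beurlingKernel w)) ε squareInd z = squareTransform 0 z := by
  have := setIntegral_squareInd_mul_kernelReg (δ := 0) (T := Set.Ioi ε) (z := z) measurableSet_Ioi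
    (integrableOn_squareInd_mul_kernelReg hε z (measurable_norm measurableSet_Ioi)
      fun w hw => le_of_lt hw)
  simp only [discTruncation, conj_beurlingKernel_eq, squareTransform]
  refine this.trans ?_
  congr 2
  ext w
  exact ⟨fun h => h.2, fun hw => ⟨h.trans_le hw, hw⟩⟩

theorem hasPrincipalValue_squareInd {z : ℂ} (h : 0 < edgeDist z) :
    HasPrincipalValue (fun w => conj (beurlingKernel w)) squareInd z (squareTransform 0 z) := by
  refine tendsto_const_nhds.congr' ?_
  filter_upwards [Ioo_mem_nhdsGT h] with ε hε
  exact (discTruncation_squareInd hε.1 hε.2).symm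

theorem beurlingInv_squareInd {z : ℂ} (h : 0 < edgeDist z) :
    beurlingInv squareInd z = squareTransform 0 z :=
  (hasPrincipalValue_squareInd h).limUnder_eq

theorem tendsto_squareTransform {z : ℂ} (h : 0 < edgeDist z) :
    Tendsto (fun δ => squareTransform δ z) (𝓝[>] 0) (𝓝 (squareTransform 0 z)) := by
  have hm : MeasurableSet {w : ℂ | edgeDist z ≤ ‖w‖} := measurable_norm measurableSet_Ici
  refine tendsto_integral_filter_of_dominated_convergence
    (fun w => unitSquare.indicator (fun _ => (1 : ℝ)) (z - w) *
      (1 / (Real.pi * edgeDist z ^ 2)))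
    (.of_forall fun δ => aestronglyMeasurable_squareInd_mul_kernelReg δ z _)
    (.of_forall fun δ => ?_)
    ((integrable_indicator_unitSquare_sub z).mul_const _).integrableOn (.of_forall fun w => ?_)
  · filter_upwards [ae_restrict_mem hm] with w hw
    refine norm_squareInd_mul_kernelReg_le.trans ?_
    have : edgeDist z ≤ ‖w‖ := hw
    gcongr
    exact Set.indicator_nonneg (fun _ _ => zero_le_one) _
  · rw [← conj_beurlingKernel_eq]
    exact (tendsto_kernelReg w).const_mul _

/-! ### A square-integrable majorant, and `f ∈ L²` -/

/-- A majorant of the transforms of the square. -/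
noncomputable def transformBound (z : ℂ) : ℝ :=
  if ‖z‖ ≤ 4 then 1 / Real.pi * (edgeDist z ^ (-(1 / 4) : ℝ) *
    (2 * Real.pi * (6 ^ ((-(7 / 4) : ℝ) + 2) / ((-(7 / 4) : ℝ) + 2)))) else 6 / ‖z‖ ^ 2

/-- For `|z| ≤ 4`, on `|w| ≥ d = edgeDist z` one has `|w|⁻² ≤ d^{-1/4} |w|^{-7/4}`. The exponent
`7/4 < 2` makes the last factor integrable over `|w| ≤ 6`, which contains all relevant `w` since `4
+ 3/2 < 6`, and the square `d^{-1/2}` of the first factor is still integrable. For `|z| > 4`, `|w| ≥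
|z|/2` on a set of area 4, and `16/π < 6`. -/
theorem norm_squareTransform_le {δ : ℝ} {z : ℂ} (h : 0 < edgeDist z) :
    ‖squareTransform δ z‖ ≤ transformBound z := by
  have hm : MeasurableSet {w : ℂ | edgeDist z ≤ ‖w‖} := measurable_norm measurableSet_Ici
  unfold transformBound
  split_ifs with hz
  · rw [squareTransform, ← setIntegral_norm_rpow_punctured (by norm_num) (by norm_num : (0:ℝ) ≤ 6),
      ← integral_const_mul, ← integral_const_mul]
    have hm6 : MeasurableSet {w : ℂ | 0 < ‖w‖ ∧ ‖w‖ ≤ 6} := measurable_norm measurableSet_Ioc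
    rw [← integral_indicator hm, ← integral_indicator hm6]
    refine norm_integral_le_of_norm_le (((integrable_indicator_iff hm6).2
      (((integrableOn_norm_rpow_punctured (by norm_num) (by norm_num)).const_mul _).const_mul _)))
      (.of_forall fun w => ?_)
    have hnn : 0 ≤ {w : ℂ | 0 < ‖w‖ ∧ ‖w‖ ≤ 6}.indicator (fun w : ℂ => 1 / Real.pi *
        (edgeDist z ^ (-(1 / 4) : ℝ) * ‖w‖ ^ (-(7 / 4) : ℝ))) w :=
      Set.indicator_nonneg (fun w hw => by positivity) _
    by_cases hw : edgeDist z ≤ ‖w‖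
    · by_cases hs : z - w ∈ unitSquare
      · have hw0 : 0 < ‖w‖ := h.trans_le hw
        have hw6 : ‖w‖ ≤ 6 := by
          have h1 := norm_le_of_mem_unitSquare hs
          have h2 : ‖w‖ ≤ ‖z‖ + ‖z - w‖ := by
            simpa using norm_sub_le z (z - w)
          linarith
        rw [Set.indicator_of_mem (by exact hw), Set.indicator_of_mem (by exact ⟨hw0, hw6⟩)]
        refine norm_squareInd_mul_kernelReg_le.trans ?_
        rw [Set.indicator_of_mem hs, one_mul, one_div_mul_eq_div, one_div, mul_inv,
          div_eq_inv_mul]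
        gcongr
        have h3 : (‖w‖ ^ 2)⁻¹ = ‖w‖ ^ (-(1 / 4) : ℝ) * ‖w‖ ^ (-(7 / 4) : ℝ) := by
          rw [← Real.rpow_add hw0]
          norm_num
        rw [h3]
        gcongr ?_ * _
        exact Real.rpow_le_rpow_of_nonpos h hw (by norm_num)
      · have : {w | edgeDist z ≤ ‖w‖}.indicator (fun w => squareInd (z - w) * kernelReg δ w) w
            = 0 := by
          rw [Set.indicator_of_mem (by exact hw), squareInd, Set.indicator_of_notMem hs, zero_mul]
        rw [this, norm_zero]
        exact hnn
    · rw [Set.indicator_of_notMem (by exact hw), norm_zero]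
      exact hnn
  · push Not at hz
    have hz0 : 0 < ‖z‖ := by linarith
    rw [squareTransform, ← integral_indicator hm]
    refine (norm_integral_le_of_norm_le ((integrable_indicator_unitSquare_sub z).mul_const
      (4 / (Real.pi * ‖z‖ ^ 2))) (.of_forall fun w => ?_)).trans ?_
    · refine (norm_indicator_le_norm_self _ _).trans ?_
      by_cases hs : z - w ∈ unitSquare
      · refine norm_squareInd_mul_kernelReg_le.trans ?_
        rw [Set.indicator_of_mem hs, one_mul, one_mul]
        have h1 := norm_le_of_mem_unitSquare hs
        have h2 : ‖z‖ ≤ ‖w‖ + ‖z - w‖ := by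
          simpa using norm_add_le w (z - w)
        have h3 : ‖z‖ ≤ 2 * ‖w‖ := by linarith
        have h4 : 0 < ‖w‖ := by linarith
        rw [div_le_div_iff₀ (by positivity) (by positivity)]
        have h5 : ‖z‖ ^ 2 ≤ (2 * ‖w‖) ^ 2 := by gcongr
        nlinarith [Real.pi_pos]
      · simp [squareInd, Set.indicator_of_notMem hs]
    · rw [integral_mul_const, integral_indicator_unitSquare_sub, ← mul_div_assoc]
      rw [div_le_div_iff₀ (by positivity) (by positivity)]
      have : (3 : ℝ) ≤ Real.pi := Real.pi_gt_three.le
      nlinarith [sq_nonneg ‖z‖]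

theorem measurable_transformBound : Measurable transformBound := by
  unfold transformBound
  have := continuous_edgeDist.measurable
  refine Measurable.ite (measurableSet_le measurable_norm measurable_const) (by fun_prop)
    (by fun_prop)

theorem transformBound_nonneg (z : ℂ) : 0 ≤ transformBound z := by
  have := edgeDist_nonneg z
  unfold transformBound
  split_ifs <;> positivity

theorem integrableOn_abs_sub_rpow (c : ℝ) {s : ℝ} (hs : -1 < s) (a b : ℝ) :
    IntegrableOn (fun x => |x - c| ^ s) (Set.Icc a b) := by
  rcases le_or_gt a b with hab | hab
  swap
  · simp [Set.Icc_eq_empty_of_lt hab]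
  rw [← intervalIntegrable_iff_integrableOn_Icc_of_le hab]
  have h : ∀ p q : ℝ, IntervalIntegrable (fun x : ℝ => |x| ^ s) volume p q := by
    have h0 : ∀ q : ℝ, 0 ≤ q → IntervalIntegrable (fun x : ℝ => |x| ^ s) volume 0 q := by
      intro q hq
      refine (intervalIntegral.intervalIntegrable_rpow' hs).congr fun x hx => ?_
      rw [Set.uIoc_of_le hq] at hx
      simp only [abs_of_pos hx.1]
    have h1 : ∀ q : ℝ, IntervalIntegrable (fun x : ℝ => |x| ^ s) volume 0 q := by
      intro q
      rcases le_total 0 q with hq | hq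
      · exact h0 q hq
      · have := (h0 (-q) (by linarith)).comp_mul_left (c := -1)
        simpa using this
    exact fun p q => (h1 p).symm.trans (h1 q)
  simpa using (h (a - c) (b - c)).comp_sub_right c

theorem integrableOn_abs_abs_sub_rpow {s : ℝ} (hs : -1 < s) (a b : ℝ) :
    IntegrableOn (fun x => |(|x| - 1)| ^ s) (Set.Icc a b) := by
  refine Integrable.mono' ((integrableOn_abs_sub_rpow 1 hs a b).add
    (integrableOn_abs_sub_rpow (-1) hs a b))
    (((by fun_prop : Continuous fun x : ℝ => |(|x| - 1)|).measurable).pow_const s).aestronglyMeasurable (.of_forall fun x => ?_)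
  rw [Real.norm_of_nonneg (by positivity)]
  simp only [Pi.add_apply]
  rcases le_total 0 x with h | h
  · rw [abs_of_nonneg h]
    have : 0 ≤ |x - -1| ^ s := by positivity
    linarith
  · rw [abs_of_nonpos h, show -x - 1 = -(x - -1) by ring, abs_neg]
    have : 0 ≤ |x - 1| ^ s := by positivity
    linarith

theorem integrableOn_re {g : ℝ → ℝ} {a b : ℝ} (hg : IntegrableOn g (Set.Icc a b)) :
    IntegrableOn (fun z : ℂ => g z.re) {z : ℂ | z.re ∈ Set.Icc a b ∧ z.im ∈ Set.Icc a b} := by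
  have h1 : IntegrableOn (fun p : ℝ × ℝ => g p.1) (Set.Icc a b ×ˢ Set.Icc a b) := by
    rw [IntegrableOn, Measure.volume_eq_prod, ← Measure.prod_restrict]
    exact Integrable.comp_fst hg _
  exact (Complex.volume_preserving_equiv_real_prod.integrableOn_comp_preimage
    Complex.measurableEquivRealProd.measurableEmbedding).2 h1

theorem integrableOn_im {g : ℝ → ℝ} {a b : ℝ} (hg : IntegrableOn g (Set.Icc a b)) :
    IntegrableOn (fun z : ℂ => g z.im) {z : ℂ | z.re ∈ Set.Icc a b ∧ z.im ∈ Set.Icc a b} := by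
  have h1 : IntegrableOn (fun p : ℝ × ℝ => g p.2) (Set.Icc a b ×ˢ Set.Icc a b) := by
    rw [IntegrableOn, Measure.volume_eq_prod, ← Measure.prod_restrict]
    exact Integrable.comp_snd hg _
  exact (Complex.volume_preserving_equiv_real_prod.integrableOn_comp_preimage
    Complex.measurableEquivRealProd.measurableEmbedding).2 h1

/-- A power of a minimum is one of the two powers, hence at most their sum; each summand depends on
one real coordinate only. -/
theorem integrableOn_edgeDist_rpow {s : ℝ} (hs : -1 < s) :
    IntegrableOn (fun z => edgeDist z ^ s) (Metric.closedBall (0 : ℂ) 4) := by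
  have h := integrableOn_abs_abs_sub_rpow hs (-4) 4
  refine Integrable.mono' (((integrableOn_re h).add (integrableOn_im h)).mono_set ?_)
    (continuous_edgeDist.measurable.pow_const s).aestronglyMeasurable (.of_forall fun z => ?_)
  · intro z hz
    rw [mem_closedBall_zero_iff] at hz
    exact ⟨abs_le.1 ((Complex.abs_re_le_norm z).trans hz),
      abs_le.1 ((Complex.abs_im_le_norm z).trans hz)⟩
  · rw [Real.norm_of_nonneg (Real.rpow_nonneg (edgeDist_nonneg z) _)]
    simp only [Pi.add_apply]
    unfold edgeDist
    have h1 : 0 ≤ |(|z.re| - 1)| ^ s := by positivity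
    have h2 : 0 ≤ |(|z.im| - 1)| ^ s := by positivity
    rcases min_choice |(|z.re| - 1)| |(|z.im| - 1)| with h | h <;> rw [h] <;> linarith

theorem integrable_transformBound_sq : Integrable fun z => transformBound z ^ 2 := by
  rw [← integrableOn_univ, ← Set.union_compl_self (Metric.closedBall (0 : ℂ) 4)]
  refine IntegrableOn.union ?_ ?_
  · refine IntegrableOn.congr_fun ((integrableOn_edgeDist_rpow (s := -(1 / 2)) (by norm_num)).const_mul
      ((1 / Real.pi * (2 * Real.pi *
        (6 ^ ((-(7 / 4) : ℝ) + 2) / ((-(7 / 4) : ℝ) + 2)))) ^ 2)) ?_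
      Metric.isClosed_closedBall.measurableSet
    intro z hz
    rw [mem_closedBall_zero_iff] at hz
    simp only [transformBound, if_pos hz]
    have : edgeDist z ^ (-(1 / 2) : ℝ) = (edgeDist z ^ (-(1 / 4) : ℝ)) ^ 2 := by
      rw [← Real.rpow_mul_natCast (edgeDist_nonneg z)]
      norm_num
    rw [this]
    ring
  · have hS : (Metric.closedBall (0 : ℂ) 4)ᶜ = {w : ℂ | 4 < ‖w‖} := by
      ext w
      simp
    rw [hS]
    refine IntegrableOn.congr_fun ((integrableOn_norm_rpow_outside (s := -4) (by norm_num)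
      (by norm_num : (0 : ℝ) < 4)).const_mul 36) ?_ (measurableSet_lt_norm 4)
    intro z hz
    have hz' : ¬ ‖z‖ ≤ 4 := not_le.2 hz
    simp only [transformBound, if_neg hz']
    rw [Real.rpow_neg (norm_nonneg z),
      show ‖z‖ ^ (4 : ℝ) = ‖z‖ ^ 4 by exact_mod_cast Real.rpow_natCast ‖z‖ 4]
    rw [div_pow, ← pow_mul]
    norm_num [div_eq_mul_inv]

theorem stronglyMeasurable_squareConv (δ : ℝ) :
    StronglyMeasurable fun z => ∫ w, squareInd (z - w) * kernelReg δ w := by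
  apply StronglyMeasurable.integral_prod_right (f := fun z w => squareInd (z - w) * kernelReg δ w)
  exact ((measurable_squareInd.comp (measurable_fst.sub measurable_snd)).mul
    ((measurable_kernelReg δ).comp measurable_snd)).stronglyMeasurable

/-- The principal value is a `limUnder`, so measurability is obtained from the smooth convolutions,
which converge to it off the four lines. -/
theorem aestronglyMeasurable_beurlingInv_squareInd :
    AEStronglyMeasurable (beurlingInv squareInd) volume := by
  refine aestronglyMeasurable_of_tendsto_ae (𝓝[>] (0 : ℝ))
    (f := fun δ z => ∫ w, squareInd (z - w) * kernelReg δ w)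
    (fun δ => (stronglyMeasurable_squareConv δ).aestronglyMeasurable) ?_
  filter_upwards [ae_edgeDist_pos] with z hz
  rw [beurlingInv_squareInd hz]
  refine (tendsto_squareTransform hz).congr' ?_
  filter_upwards [self_mem_nhdsWithin] with δ hδ
  exact (integral_squareInd_mul_kernelReg hδ z).symm

theorem norm_beurlingInv_squareInd_le {z : ℂ} (h : 0 < edgeDist z) :
    ‖beurlingInv squareInd z‖ ≤ transformBound z := by
  rw [beurlingInv_squareInd h]
  exact norm_squareTransform_le h

theorem memLp_beurlingInv_squareInd : MemLp (beurlingInv squareInd) 2 volume := by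
  rw [memLp_two_iff_integrable_sq_norm aestronglyMeasurable_beurlingInv_squareInd]
  refine Integrable.mono' integrable_transformBound_sq
    (aestronglyMeasurable_beurlingInv_squareInd.norm.pow 2) ?_
  filter_upwards [ae_edgeDist_pos] with z hz
  rw [Real.norm_of_nonneg (by positivity)]
  have := norm_beurlingInv_squareInd_le hz
  gcongr

/-! ### Truncations of `B f` as disc averages of `χ` -/

theorem integrableOn_norm_beurlingKernel_sq {ε : ℝ} (hε : 0 < ε) :
    IntegrableOn (fun w => ‖beurlingKernel w‖ ^ 2) {w : ℂ | ε < ‖w‖} := by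
  refine IntegrableOn.congr_fun ((integrableOn_norm_rpow_outside (s := -4) (by norm_num)
    hε).const_mul (1 / Real.pi ^ 2)) ?_ (measurableSet_lt_norm ε)
  intro w hw
  simp only
  rw [norm_beurlingKernel, Real.rpow_neg (norm_nonneg w),
    show ‖w‖ ^ (4 : ℝ) = ‖w‖ ^ 4 by exact_mod_cast Real.rpow_natCast ‖w‖ 4]
  rw [div_pow, mul_pow, ← pow_mul]
  norm_num [div_eq_mul_inv, mul_comm]

/-- Used in place of Cauchy–Schwarz: it gives an explicit integrable dominating function for a
product of two square-integrable factors. -/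
theorem mul_le_half_sq_add_sq (x y : ℝ) : x * y ≤ (x ^ 2 + y ^ 2) / 2 := by
  nlinarith [sq_nonneg (x - y)]

theorem ae_edgeDist_sub_pos (z : ℂ) : ∀ᵐ w : ℂ, 0 < edgeDist (z - w) :=
  (quasiMeasurePreserving_sub_left volume z).ae ae_edgeDist_pos

theorem integrableOn_transformBound_sq_add (z : ℂ) {ε : ℝ} (hε : 0 < ε) :
    IntegrableOn (fun w => (transformBound (z - w) ^ 2 + ‖beurlingKernel w‖ ^ 2) / 2)
      {w : ℂ | ε < ‖w‖} :=
  ((integrable_transformBound_sq.comp_sub_left z).integrableOn.add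
    (integrableOn_norm_beurlingKernel_sq hε)).div_const 2

theorem norm_squareTransform_mul_beurlingKernel_le {δ : ℝ} {z w : ℂ}
    (h : 0 < edgeDist (z - w)) :
    ‖squareTransform δ (z - w) * beurlingKernel w‖ ≤
      (transformBound (z - w) ^ 2 + ‖beurlingKernel w‖ ^ 2) / 2 := by
  rw [norm_mul]
  refine le_trans ?_ (mul_le_half_sq_add_sq _ _)
  gcongr
  exact norm_squareTransform_le h

/-- Truncations of the Beurling transform of `B⁻¹χ` are limits of truncations of the transforms of
the smooth approximations of `B⁻¹χ`. -/
theorem tendsto_discTruncation (z : ℂ) {ε : ℝ} (hε : 0 < ε) :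
    Tendsto (fun δ => ∫ w in {w : ℂ | ε < ‖w‖},
      (∫ u, squareInd (z - w - u) * kernelReg δ u) * beurlingKernel w) (𝓝[>] 0)
      (𝓝 (discTruncation beurlingKernel ε (beurlingInv squareInd) z)) := by
  have hae := ae_restrict_of_ae (s := {w : ℂ | ε < ‖w‖}) (ae_edgeDist_sub_pos z)
  refine tendsto_integral_filter_of_dominated_convergence
    (fun w => (transformBound (z - w) ^ 2 + ‖beurlingKernel w‖ ^ 2) / 2)
    (.of_forall fun δ => ?_) ?_ (integrableOn_transformBound_sq_add z hε) ?_
  · exact ((stronglyMeasurable_squareConv δ).comp_measurable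
      (measurable_id.const_sub z)).aestronglyMeasurable.mul
      measurable_beurlingKernel.aestronglyMeasurable
  · filter_upwards [self_mem_nhdsWithin] with δ hδ
    filter_upwards [hae] with w hw
    rw [integral_squareInd_mul_kernelReg hδ]
    exact norm_squareTransform_mul_beurlingKernel_le hw
  · filter_upwards [hae] with w hw
    rw [beurlingInv_squareInd hw]
    refine ((tendsto_squareTransform hw).congr' ?_).mul_const _
    filter_upwards [self_mem_nhdsWithin] with δ hδ
    exact (integral_squareInd_mul_kernelReg hδ _).symm

theorem integral_squareInd_mul_kernelReg_eq_setIntegral (δ : ℝ) (z : ℂ) :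
    ∫ u, squareInd (z - u) * kernelReg δ u = ∫ v in unitSquare, kernelReg δ (z - v) := by
  rw [← integral_sub_left_eq_self (fun u => squareInd (z - u) * kernelReg δ u) volume z,
    ← integral_indicator measurableSet_unitSquare]
  congr 1
  ext v
  by_cases h : v ∈ unitSquare <;> simp [squareInd, h]

/-- Fubini brings the truncated Beurling integral inside the integral over the square. Evenness of
`kernelReg δ` makes the inner function a translate by `z - v`, to which the Green identity applies.
-/
theorem setIntegral_squareConv_mul_beurlingKernel (z : ℂ) {δ ε : ℝ} (hδ : 0 < δ) (hε : 0 < ε) :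
    ∫ w in {w : ℂ | ε < ‖w‖},
      (∫ u, squareInd (z - w - u) * kernelReg δ u) * beurlingKernel w =
    ∫ v in unitSquare, 1 / (Real.pi * ε ^ 2) *
      ∫ w in Metric.ball (0 : ℂ) ε, (approxId δ (w - (z - v)) : ℂ) := by
  have hk : ∀ w v, kernelReg δ (z - w - v) = kernelReg δ (w - (z - v)) := by
    intro w v
    rw [← kernelReg_neg]
    congr 1
    ring
  simp only [integral_squareInd_mul_kernelReg_eq_setIntegral, ← integral_mul_const, hk]
  rw [integral_integral_swap]
  · exact integral_congr_ae (.of_forall fun v =>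
      setIntegral_kernelReg_mul_beurlingKernel hδ hε (z - v))
  · have hfin : IsFiniteMeasure (volume.restrict unitSquare) :=
      ⟨by simpa using volume_unitSquare_lt_top⟩
    have hb : Integrable (fun p : ℂ × ℂ => 2 * (1 + (‖z‖ + 3 / 2) ^ 2 / δ ^ 2) / Real.pi ^ 2 *
        ‖p.1‖ ^ (-4 : ℝ)) ((volume.restrict {w : ℂ | ε < ‖w‖}).prod
          (volume.restrict unitSquare)) :=
      Integrable.comp_fst ((integrableOn_norm_rpow_outside (s := -4) (by norm_num) hε).const_mul
        (2 * (1 + (‖z‖ + 3 / 2) ^ 2 / δ ^ 2) / Real.pi ^ 2)) _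
    refine Integrable.mono' hb ?_ ?_
    · have h1 : Measurable fun p : ℂ × ℂ => p.1 - (z - p.2) := by fun_prop
      exact (((measurable_kernelReg δ).comp h1).mul
        (measurable_beurlingKernel.comp measurable_fst)).aestronglyMeasurable
    · rw [Measure.prod_restrict]
      filter_upwards [ae_restrict_mem ((measurableSet_lt_norm ε).prod measurableSet_unitSquare)]
        with p hp
      refine norm_kernelReg_mul_beurlingKernel_le hδ hε ?_ hp.1
      exact (norm_sub_le _ _).trans (by gcongr; exact norm_le_of_mem_unitSquare hp.2)

theorem approxId_nonneg (δ : ℝ) (u : ℂ) : 0 ≤ approxId δ u := by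
  unfold approxId
  positivity

theorem approxId_le {δ a : ℝ} (ha : 0 < a) {u : ℂ} (hu : a ≤ ‖u‖) :
    approxId δ u ≤ δ ^ 2 / (Real.pi * a ^ 4) := by
  unfold approxId
  have : a ^ 4 ≤ (‖u‖ ^ 2 + δ ^ 2) ^ 2 := by
    have h1 : a ^ 2 ≤ ‖u‖ ^ 2 + δ ^ 2 := by
      have : a ^ 2 ≤ ‖u‖ ^ 2 := by gcongr
      nlinarith
    calc a ^ 4 = (a ^ 2) ^ 2 := by ring
      _ ≤ _ := by gcongr
  gcongr

theorem integrableOn_approxId {δ : ℝ} (hδ : 0 < δ) (y : ℂ) (r : ℝ) :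
    IntegrableOn (approxId δ) (Metric.ball y r) :=
  ((continuous_approxId hδ).continuousOn.integrableOn_compact
    (isCompact_closedBall y r)).mono_set Metric.ball_subset_closedBall

theorem setIntegral_ball_approxId_real {δ a : ℝ} (hδ : 0 < δ) (ha : 0 < a) :
    ∫ w in Metric.ball (0 : ℂ) a, approxId δ w = a ^ 2 / (a ^ 2 + δ ^ 2) := by
  have := setIntegral_ball_approxId hδ ha
  rw [integral_complex_ofReal] at this
  exact_mod_cast this

theorem setIntegral_approxId_sub (δ : ℝ) (y : ℂ) (r : ℝ) :
    ∫ w in Metric.ball (0 : ℂ) r, approxId δ (w - y) =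
      ∫ w in Metric.ball (-y) r, approxId δ w := by
  rw [← integral_indicator Metric.isOpen_ball.measurableSet,
    ← integral_indicator Metric.isOpen_ball.measurableSet,
    ← integral_sub_right_eq_self ((Metric.ball (-y) r).indicator (approxId δ)) y]
  congr 1
  ext w
  have : w - y ∈ Metric.ball (-y) r ↔ w ∈ Metric.ball (0 : ℂ) r := by
    simp [dist_eq_norm]
  by_cases h : w ∈ Metric.ball (0 : ℂ) r
  · rw [Set.indicator_of_mem h, Set.indicator_of_mem (this.2 h)]
  · rw [Set.indicator_of_notMem h, Set.indicator_of_notMem (fun h' => h (this.1 h'))]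

theorem setIntegral_approxId_sub_le_one {δ : ℝ} (hδ : 0 < δ) (y : ℂ) {r : ℝ} (hr : 0 < r) :
    ∫ w in Metric.ball (0 : ℂ) r, approxId δ (w - y) ≤ 1 := by
  rw [setIntegral_approxId_sub]
  have h1 : Metric.ball (-y) r ⊆ Metric.ball (0 : ℂ) (r + ‖y‖) :=
    Metric.ball_subset_ball' (by simp)
  calc _ ≤ ∫ w in Metric.ball (0 : ℂ) (r + ‖y‖), approxId δ w :=
        setIntegral_mono_set (integrableOn_approxId hδ _ _)
          (.of_forall fun u => approxId_nonneg δ u) h1.eventuallyLE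
    _ = (r + ‖y‖) ^ 2 / ((r + ‖y‖) ^ 2 + δ ^ 2) :=
        setIntegral_ball_approxId_real hδ (by positivity)
    _ ≤ 1 := div_le_one_of_le₀ (by nlinarith) (by positivity)

/-- If `|y| < r`, the ball about `-y` contains the centred ball of radius `r - |y|`, whose mass
tends to 1. If `|y| > r`, the integrand is `O(δ²)` at distance at least `|y| - r` from its peak. -/
theorem tendsto_setIntegral_approxId_sub {y : ℂ} {r : ℝ} (hr : 0 < r) (hy : ‖y‖ ≠ r) :
    Tendsto (fun δ => ∫ w in Metric.ball (0 : ℂ) r, approxId δ (w - y)) (𝓝[>] 0)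
      (𝓝 ((Metric.ball (0 : ℂ) r).indicator (fun _ => 1) y)) := by
  rcases lt_or_gt_of_ne hy with h | h
  · rw [Set.indicator_of_mem (by simpa using h)]
    have ha : 0 < r - ‖y‖ := by linarith
    have hlim : Tendsto (fun δ : ℝ => (r - ‖y‖) ^ 2 / ((r - ‖y‖) ^ 2 + δ ^ 2)) (𝓝[>] 0)
        (𝓝 1) := by
      have : ContinuousAt (fun δ : ℝ => (r - ‖y‖) ^ 2 / ((r - ‖y‖) ^ 2 + δ ^ 2)) 0 :=
        ContinuousAt.div (by fun_prop) (by fun_prop) (by positivity)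
      have h2 := this.tendsto
      rw [show (r - ‖y‖) ^ 2 / ((r - ‖y‖) ^ 2 + (0 : ℝ) ^ 2) = 1 by
        rw [zero_pow two_ne_zero, add_zero, div_self (by positivity)]] at h2
      exact tendsto_nhdsWithin_of_tendsto_nhds h2
    refine tendsto_of_tendsto_of_tendsto_of_le_of_le' hlim tendsto_const_nhds ?_ ?_
    · filter_upwards [self_mem_nhdsWithin] with δ hδ
      rw [setIntegral_approxId_sub, ← setIntegral_ball_approxId_real hδ ha]
      have h1 : Metric.ball (0 : ℂ) (r - ‖y‖) ⊆ Metric.ball (-y) r :=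
        Metric.ball_subset_ball' (by simp)
      exact setIntegral_mono_set (integrableOn_approxId hδ _ _)
        (.of_forall fun u => approxId_nonneg δ u) h1.eventuallyLE
    · filter_upwards [self_mem_nhdsWithin] with δ hδ
      exact setIntegral_approxId_sub_le_one hδ y hr
  · rw [Set.indicator_of_notMem (by simpa using h.le)]
    have ha : 0 < ‖y‖ - r := by linarith
    have hlim : Tendsto (fun δ : ℝ => δ ^ 2 / (Real.pi * (‖y‖ - r) ^ 4) *
        volume.real (Metric.ball (0 : ℂ) r)) (𝓝[>] 0) (𝓝 0) := by
      have : Continuous fun δ : ℝ => δ ^ 2 / (Real.pi * (‖y‖ - r) ^ 4) *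
        volume.real (Metric.ball (0 : ℂ) r) := by fun_prop
      have h2 := this.tendsto 0
      simp only [zero_pow two_ne_zero, zero_div, zero_mul] at h2
      exact tendsto_nhdsWithin_of_tendsto_nhds h2
    refine squeeze_zero_norm (fun δ => ?_) hlim
    refine norm_setIntegral_le_of_norm_le_const measure_ball_lt_top fun w hw => ?_
    rw [Real.norm_of_nonneg (approxId_nonneg _ _)]
    refine approxId_le ha ?_
    have h1 : ‖y‖ ≤ ‖w‖ + ‖w - y‖ := by
      simpa using norm_sub_le w (w - y)
    have h2 : ‖w‖ < r := by simpa using hw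
    linarith

/-- The truncations of `B (B⁻¹χ)` are the averages of `χ` over discs. -/
theorem discTruncation_beurlingInv_squareInd (z : ℂ) {ε : ℝ} (hε : 0 < ε) :
    discTruncation beurlingKernel ε (beurlingInv squareInd) z =
      ∫ v in unitSquare, 1 / (Real.pi * ε ^ 2) *
        (((Metric.ball (0 : ℂ) ε).indicator (fun _ => (1 : ℝ)) (z - v) : ℝ) : ℂ) := by
  have hfin : IsFiniteMeasure (volume.restrict unitSquare) :=
    ⟨by simpa using volume_unitSquare_lt_top⟩
  refine tendsto_nhds_unique (tendsto_discTruncation z hε) ?_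
  have h2 : Tendsto (fun δ => ∫ v in unitSquare, 1 / (Real.pi * ε ^ 2) *
      ((∫ w in Metric.ball (0 : ℂ) ε, approxId δ (w - (z - v)) : ℝ) : ℂ)) (𝓝[>] 0)
      (𝓝 (∫ v in unitSquare, 1 / (Real.pi * ε ^ 2) *
        (((Metric.ball (0 : ℂ) ε).indicator (fun _ => (1 : ℝ)) (z - v) : ℝ) : ℂ))) := by
    refine tendsto_integral_filter_of_dominated_convergence
      (fun _ => ‖(1 / (Real.pi * ε ^ 2) : ℂ)‖) ?_ ?_ (integrable_const _) ?_
    · filter_upwards [self_mem_nhdsWithin] with δ hδ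
      have h1 : StronglyMeasurable fun v : ℂ =>
          ∫ w in Metric.ball (0 : ℂ) ε, approxId δ (w - (z - v)) := by
        apply StronglyMeasurable.integral_prod_right
          (f := fun v w => approxId δ (w - (z - v)))
        have h3 : Continuous fun p : ℂ × ℂ => p.2 - (z - p.1) := by fun_prop
        exact ((continuous_approxId hδ).comp h3).stronglyMeasurable
      exact ((Complex.continuous_ofReal.comp_stronglyMeasurable h1).const_mul
        _).aestronglyMeasurable
    · filter_upwards [self_mem_nhdsWithin] with δ hδ
      refine .of_forall fun v => ?_
      rw [norm_mul, Complex.norm_real, Real.norm_of_nonneg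
        (integral_nonneg fun w => approxId_nonneg _ _)]
      exact mul_le_of_le_one_right (norm_nonneg _) (setIntegral_approxId_sub_le_one hδ _ hε)
    -- The excluded case `|z - v| = ε` is a circle, hence null.
    · have hs : ∀ᵐ v : ℂ, v ∉ Metric.sphere z ε :=
        measure_eq_zero_iff_ae_notMem.1 (Measure.addHaar_sphere volume z ε)
      filter_upwards [ae_restrict_of_ae hs] with v hv
      refine (Complex.continuous_ofReal.continuousAt.tendsto.comp
        (tendsto_setIntegral_approxId_sub hε ?_)).const_mul _
      rwa [mem_sphere_iff_norm, norm_sub_rev] at hv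
  refine h2.congr' ?_
  filter_upwards [self_mem_nhdsWithin] with δ hδ
  rw [setIntegral_squareConv_mul_beurlingKernel z hδ hε]
  simp only [integral_complex_ofReal]

/-- A disc about `z` that reaches none of the four lines lies inside the square or misses it, so its
average of `χ` is `χ(z)`. -/
theorem discTruncation_beurlingInv_squareInd_of_lt {z : ℂ} {ε : ℝ} (hε : 0 < ε)
    (h : ε < edgeDist z) :
    discTruncation beurlingKernel ε (beurlingInv squareInd) z = squareInd z := by
  rw [discTruncation_beurlingInv_squareInd z hε, integral_const_mul, integral_complex_ofReal,
    ← integral_indicator measurableSet_unitSquare]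
  have h1 : ∀ v, unitSquare.indicator
      (fun v => (Metric.ball (0 : ℂ) ε).indicator (fun _ => (1 : ℝ)) (z - v)) v =
      unitSquare.indicator (fun _ => (1 : ℝ)) z * (Metric.ball z ε).indicator (fun _ => 1) v := by
    intro v
    have hb : z - v ∈ Metric.ball (0 : ℂ) ε ↔ v ∈ Metric.ball z ε := by
      rw [mem_ball_zero_iff, mem_ball_iff_norm, norm_sub_rev]
    by_cases hv : v ∈ Metric.ball z ε
    · have h3 : ‖z - v‖ < edgeDist z := (mem_ball_zero_iff.1 (hb.2 hv)).trans h
      have h4 := sub_mem_unitSquare_iff h3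
      rw [sub_sub_cancel] at h4
      by_cases hz : z ∈ unitSquare
      · simp [hz, h4.2 hz, hv, hb.2 hv]
      · have h5 : v ∉ unitSquare := fun h5 => hz (h4.1 h5)
        simp [hz, h5]
    · have h5 : z - v ∉ Metric.ball (0 : ℂ) ε := fun h5 => hv (hb.1 h5)
      by_cases h6 : v ∈ unitSquare
      · rw [Set.indicator_of_mem h6, Set.indicator_of_notMem h5, Set.indicator_of_notMem hv,
          mul_zero]
      · rw [Set.indicator_of_notMem h6, Set.indicator_of_notMem hv, mul_zero]
  simp only [h1]
  rw [integral_const_mul, integral_indicator Metric.isOpen_ball.measurableSet]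
  have hv : volume.real (Metric.ball z ε) = Real.pi * ε ^ 2 := by
    simp [Measure.real, Complex.volume_ball, hε.le, mul_comm]
  simp only [integral_const, measureReal_restrict_apply_univ, hv, smul_eq_mul, mul_one]
  have := ofReal_pi_ne_zero
  have : (ε : ℂ) ≠ 0 := by exact_mod_cast hε.ne'
  by_cases hz : z ∈ unitSquare
  · simp only [squareInd, Set.indicator_of_mem hz]
    push_cast
    field_simp
  · simp [squareInd, Set.indicator_of_notMem hz]

theorem hasPrincipalValue_beurlingInv_squareInd {z : ℂ} (h : 0 < edgeDist z) :
    HasPrincipalValue beurlingKernel (beurlingInv squareInd) z (squareInd z) := by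
  refine tendsto_const_nhds.congr' ?_
  filter_upwards [Ioo_mem_nhdsGT h] with ε hε
  exact (discTruncation_beurlingInv_squareInd_of_lt hε.1 hε.2).symm

/-! ### Decay of `f` at infinity -/

theorem norm_beurlingKernel_sub_le {z w : ℂ} (hz : z ≠ 0) (hw : w ≠ 0) :
    ‖beurlingKernel w - beurlingKernel z‖ ≤
      ‖z - w‖ * (‖z‖ + ‖w‖) / (Real.pi * ‖z‖ ^ 2 * ‖w‖ ^ 2) := by
  have := ofReal_pi_ne_zero
  have h : beurlingKernel w - beurlingKernel z =
      -((z - w) * (z + w)) / (Real.pi * z ^ 2 * w ^ 2) := by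
    unfold beurlingKernel
    field_simp
    ring
  rw [h, norm_div, norm_neg, norm_mul, norm_mul, norm_mul, norm_pow, norm_pow, Complex.norm_real,
    Real.norm_of_nonneg Real.pi_pos.le]
  gcongr
  exact norm_add_le _ _

/-- Outside the square the omitted part of the integral has integrand zero. -/
theorem squareTransform_zero_of_notMem {z : ℂ} (hz : z ∉ unitSquare) :
    squareTransform 0 z = ∫ w, squareInd (z - w) * conj (beurlingKernel w) := by
  have hm : MeasurableSet {w : ℂ | edgeDist z ≤ ‖w‖} := measurable_norm measurableSet_Ici
  rw [squareTransform, ← integral_indicator hm]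
  congr 1
  ext w
  rw [conj_beurlingKernel_eq]
  by_cases h : edgeDist z ≤ ‖w‖
  · rw [Set.indicator_of_mem (by exact h)]
  · rw [Set.indicator_of_notMem (by exact h), squareInd_sub (not_le.1 h), squareInd,
      Set.indicator_of_notMem hz, zero_mul]

/-- The decay of `B⁻¹χ` at infinity. -/
theorem norm_beurlingInv_squareInd_sub_le {z : ℂ} (hz : 4 < ‖z‖) (hd : 0 < edgeDist z) :
    ‖beurlingInv squareInd z - 4 * conj (beurlingKernel z)‖ ≤ 20 * ‖z‖ ^ (-3 : ℝ) := by
  have hzQ : z ∉ unitSquare := fun h => by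
    have := norm_le_of_mem_unitSquare h
    linarith
  have hz0 : z ≠ 0 := norm_pos_iff.1 (by linarith)
  have hzp : 0 < ‖z‖ := norm_pos_iff.2 hz0
  have hsq : ∀ w, squareInd (z - w) = (unitSquare.indicator (fun _ => (1 : ℝ)) (z - w) : ℝ) := by
    intro w
    by_cases h : z - w ∈ unitSquare <;> simp [squareInd, h]
  -- The leading term is the same integral with the kernel frozen at `z`; the error is then the
  -- variation of the kernel over a set of area 4.
  have h4 : (4 : ℂ) * conj (beurlingKernel z) =
      ∫ w, squareInd (z - w) * conj (beurlingKernel z) := by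
    rw [integral_mul_const]
    simp only [hsq]
    rw [integral_complex_ofReal, integral_indicator_unitSquare_sub]
    norm_num
  have hi1 : Integrable fun w => squareInd (z - w) * conj (beurlingKernel z) := by
    simp only [hsq]
    exact ((integrable_indicator_unitSquare_sub z).ofReal).mul_const _
  have hbound : ∀ w, z - w ∈ unitSquare → ‖z‖ ≤ 2 * ‖w‖ ∧ ‖w‖ ≤ 3 / 2 * ‖z‖ ∧ ‖z - w‖ ≤ 3 / 2 := by
    intro w hw
    have h1 := norm_le_of_mem_unitSquare hw
    have h2 : ‖z‖ ≤ ‖w‖ + ‖z - w‖ := by simpa using norm_add_le w (z - w)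
    have h3 : ‖w‖ ≤ ‖z‖ + ‖z - w‖ := by simpa using norm_sub_le z (z - w)
    refine ⟨?_, ?_, h1⟩ <;> linarith
  have hi2 : Integrable fun w => squareInd (z - w) * conj (beurlingKernel w) := by
    have hS : MeasurableSet {w : ℂ | 1 < ‖w‖} := measurableSet_lt_norm 1
    have := integrableOn_squareInd_mul_kernelReg (δ := 0) one_pos z hS fun w hw => le_of_lt hw
    rw [← integrable_indicator_iff hS] at this
    refine this.congr (.of_forall fun w => ?_)
    simp only [conj_beurlingKernel_eq]
    by_cases h : 1 < ‖w‖
    · rw [Set.indicator_of_mem (by exact h)]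
    · rw [Set.indicator_of_notMem (by exact h), squareInd, Set.indicator_of_notMem, zero_mul]
      intro h'
      have := (hbound w h').1
      linarith
  rw [beurlingInv_squareInd hd, squareTransform_zero_of_notMem hzQ, h4, ← integral_sub hi2 hi1]
  refine (norm_integral_le_of_norm_le ((integrable_indicator_unitSquare_sub z).mul_const
    (5 * ‖z‖ ^ (-3 : ℝ))) (.of_forall fun w => ?_)).trans (le_of_eq ?_)
  · rw [← mul_sub, ← map_sub, norm_mul, RCLike.norm_conj, hsq, Complex.norm_real,
      Real.norm_of_nonneg (Set.indicator_nonneg (fun _ _ => zero_le_one) _)]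
    by_cases h : z - w ∈ unitSquare
    · rw [Set.indicator_of_mem h, one_mul, one_mul]
      obtain ⟨h1, h2, h3⟩ := hbound w h
      have hwp : 0 < ‖w‖ := by linarith
      refine (norm_beurlingKernel_sub_le hz0 (norm_pos_iff.1 hwp)).trans ?_
      rw [Real.rpow_neg hzp.le, show ‖z‖ ^ (3 : ℝ) = ‖z‖ ^ 3 by
        exact_mod_cast Real.rpow_natCast ‖z‖ 3, ← div_eq_mul_inv]
      calc ‖z - w‖ * (‖z‖ + ‖w‖) / (Real.pi * ‖z‖ ^ 2 * ‖w‖ ^ 2)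
          ≤ 3 / 2 * (‖z‖ + 3 / 2 * ‖z‖) / (3 * ‖z‖ ^ 2 * (‖z‖ / 2) ^ 2) := by
            have := Real.pi_gt_three
            gcongr
            linarith
        _ = 5 / ‖z‖ ^ 3 := by field_simp; norm_num
    · rw [Set.indicator_of_notMem h, zero_mul, zero_mul]
  · rw [integral_mul_const, integral_indicator_unitSquare_sub]
    ring

/-! ### The truncation with a corner at the origin -/

/-- The angular factor `e^{2iθ}` makes only half a turn over a right angle, so its integral is `i`
instead of zero; the radial integral of `1/r` supplies the logarithm. -/
theorem setIntegral_quadrant_conj_beurlingKernel {a b : ℝ} (ha : 0 < a) (hab : a ≤ b) :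
    ∫ w in {w : ℂ | a < ‖w‖ ∧ ‖w‖ ≤ b} ∩ {w : ℂ | 0 ≤ w.re ∧ 0 ≤ w.im}, conj (beurlingKernel w) =
      -(Complex.I / Real.pi) * Real.log (b / a) := by
  have hpi := Real.pi_pos
  have hmr : Measurable Complex.re := Complex.measurable_re
  have hmi : Measurable Complex.im := Complex.measurable_im
  have hset : ({w : ℂ | a < ‖w‖ ∧ ‖w‖ ≤ b} ∩ {w : ℂ | 0 ≤ w.re ∧ 0 ≤ w.im} : Set ℂ) =ᵐ[volume]
      ({w : ℂ | a < ‖w‖ ∧ ‖w‖ ≤ b} ∩ {w : ℂ | 0 < w.re ∧ 0 < w.im} : Set ℂ) := by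
    have h0 : ∀ᵐ x : ℝ, x ≠ 0 := Measure.ae_ne volume 0
    filter_upwards [quasiMeasurePreserving_re.ae h0, quasiMeasurePreserving_im.ae h0] with w h1 h2
    apply propext
    exact and_congr_right fun _ => and_congr (le_iff_lt_or_eq.trans (or_iff_left h1.symm))
      (le_iff_lt_or_eq.trans (or_iff_left h2.symm))
  have hm : MeasurableSet ({w : ℂ | a < ‖w‖ ∧ ‖w‖ ≤ b} ∩ {w : ℂ | 0 < w.re ∧ 0 < w.im}) :=
    (measurable_norm measurableSet_Ioc).inter
      ((measurableSet_lt measurable_const hmr).inter (measurableSet_lt measurable_const hmi))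
  have hT : MeasurableSet (Set.Ioc a b ×ˢ Set.Ioo 0 (Real.pi / 2)) :=
    measurableSet_Ioc.prod measurableSet_Ioo
  rw [setIntegral_congr_set hset, ← integral_indicator hm, ← Complex.integral_comp_polarCoord_symm]
  have h1 : ∀ p ∈ polarCoord.target,
      p.1 • (({w : ℂ | a < ‖w‖ ∧ ‖w‖ ≤ b} ∩ {w : ℂ | 0 < w.re ∧ 0 < w.im}).indicator
        (fun w => conj (beurlingKernel w)) (Complex.polarCoord.symm p)) =
      (Set.Ioc a b ×ˢ Set.Ioo 0 (Real.pi / 2)).indicator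
        (fun p : ℝ × ℝ => (-(1 / Real.pi) * ((p.1⁻¹ : ℝ) : ℂ)) *
          Complex.exp (2 * Complex.I * p.2)) p := by
    rintro ⟨r, θ⟩ ⟨hr, hθ⟩
    simp only [Set.mem_Ioi] at hr
    have hre : (Complex.polarCoord.symm (r, θ)).re = r * Real.cos θ := by
      simp [Complex.cos_ofReal_re]
    have him : (Complex.polarCoord.symm (r, θ)).im = r * Real.sin θ := by
      simp [Complex.sin_ofReal_re]
    have hmem : Complex.polarCoord.symm (r, θ) ∈
        ({w : ℂ | a < ‖w‖ ∧ ‖w‖ ≤ b} ∩ {w : ℂ | 0 < w.re ∧ 0 < w.im}) ↔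
        (r, θ) ∈ Set.Ioc a b ×ˢ Set.Ioo 0 (Real.pi / 2) := by
      simp only [Set.mem_inter_iff, Set.mem_ofPred_eq, Complex.norm_polarCoord_symm, hre, him,
        abs_of_pos hr, mul_pos_iff_of_pos_left hr, Set.mem_prod, Set.mem_Ioc]
      refine and_congr_right fun _ => ⟨fun ⟨hc, hs⟩ => ?_, fun h => ?_⟩
      · constructor
        · by_contra h
          push Not at h
          have := Real.sin_nonpos_of_nonpos_of_neg_pi_le h hθ.1.le
          linarith
        · by_contra h
          push Not at h
          have := Real.cos_nonpos_of_pi_div_two_le_of_le h (by linarith [hθ.2])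
          linarith
      · exact ⟨Real.cos_pos_of_mem_Ioo ⟨by linarith [h.1], h.2⟩,
          Real.sin_pos_of_pos_of_lt_pi h.1 (by linarith [h.2])⟩
    by_cases h : (r, θ) ∈ Set.Ioc a b ×ˢ Set.Ioo 0 (Real.pi / 2)
    · rw [Set.indicator_of_mem (hmem.2 h), Set.indicator_of_mem h]
      have hp : Complex.polarCoord.symm (r, θ) = r * Complex.exp (θ * Complex.I) := by
        simp [Complex.exp_mul_I]
      have hr' : (r : ℂ) ≠ 0 := by exact_mod_cast hr.ne'
      have he : Complex.exp (2 * Complex.I * θ) = Complex.exp (θ * Complex.I) ^ 2 := by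
        rw [← Complex.exp_nat_mul]
        congr 1
        push_cast
        ring
      have := ofReal_pi_ne_zero
      have hn : ‖(r : ℂ) * Complex.exp (θ * Complex.I)‖ = r := by
        rw [norm_mul, Complex.norm_exp_ofReal_mul_I, Complex.norm_real,
          Real.norm_of_nonneg hr.le, mul_one]
      rw [hp, conj_beurlingKernel_eq, kernelReg, mul_conj_add_sq, hn, Complex.real_smul]
      simp only [he]
      push_cast
      field_simp
      ring
    · rw [Set.indicator_of_notMem (fun h' => h (hmem.1 h')), Set.indicator_of_notMem h, smul_zero]
  have h2 : polarCoord.target ∩ Set.Ioc a b ×ˢ Set.Ioo 0 (Real.pi / 2) =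
      Set.Ioc a b ×ˢ Set.Ioo 0 (Real.pi / 2) := by
    apply Set.inter_eq_right.2
    rintro ⟨r, θ⟩ ⟨hr, hθ⟩
    exact ⟨ha.trans hr.1, by linarith [hθ.1], by linarith [hθ.2]⟩
  rw [setIntegral_congr_fun polarCoord.open_target.measurableSet h1, setIntegral_indicator hT, h2,
    Measure.volume_eq_prod, setIntegral_prod_mul (fun r : ℝ => -(1 / Real.pi) * ((r⁻¹ : ℝ) : ℂ))
      (fun θ : ℝ => Complex.exp (2 * Complex.I * θ)), integral_const_mul,
    integral_complex_ofReal, ← intervalIntegral.integral_of_le hab,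
    integral_inv_of_pos ha (ha.trans_le hab), ← integral_Ioc_eq_integral_Ioo,
    ← intervalIntegral.integral_of_le (by positivity),
    integral_exp_mul_complex (by simp)]
  have : Complex.exp (2 * Complex.I * ((Real.pi / 2 : ℝ) : ℂ)) = -1 := by
    rw [← Complex.exp_pi_mul_I]
    congr 1
    push_cast
    ring
  rw [this]
  have := ofReal_pi_ne_zero
  have := Complex.I_ne_zero
  simp only [Complex.ofReal_zero, mul_zero, Complex.exp_zero]
  field_simp
  linear_combination (2 * (Real.log (b / a) : ℂ)) * Complex.I_sq

/-- The complement of the square with centre `α + iα` and side length `2α`, which has a corner at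
the origin. -/
def cornerRegion (α : ℝ) : Set ℂ := {w : ℂ | α < |α - w.re| ∨ α < |α - w.im|}

theorem measurableSet_cornerRegion (α : ℝ) : MeasurableSet (cornerRegion α) := by
  have hr : Measurable Complex.re := Complex.measurable_re
  have hi : Measurable Complex.im := Complex.measurable_im
  exact (measurableSet_lt measurable_const (by fun_prop : Measurable fun w : ℂ => |α - w.re|)).union
    (measurableSet_lt measurable_const (by fun_prop : Measurable fun w : ℂ => |α - w.im|))

theorem beurlingSquareTruncation_corner (f : ℂ → ℂ) {α : ℝ} {z : ℂ}
    (hz : z = (α : ℂ) + Complex.I * (α : ℂ)) :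
    beurlingSquareTruncation (2 * α) f z =
      ∫ w in cornerRegion α, f w * beurlingKernel (z - w) := by
  have hm : MeasurableSet (axisSquare 0 (2 * α))ᶜ := by
    have hr : Measurable Complex.re := Complex.measurable_re
    have hi : Measurable Complex.im := Complex.measurable_im
    have h : axisSquare 0 (2 * α) =
        {w : ℂ | |(w - 0).re| ≤ 2 * α / 2} ∩ {w : ℂ | |(w - 0).im| ≤ 2 * α / 2} := rfl
    rw [h]
    refine MeasurableSet.compl ((measurableSet_le ?_ measurable_const).inter
      (measurableSet_le ?_ measurable_const)) <;> fun_prop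
  rw [beurlingSquareTruncation, ← integral_indicator hm,
    ← integral_indicator (measurableSet_cornerRegion α),
    ← integral_sub_left_eq_self _ volume z]
  congr 1
  ext w
  have h : z - w ∈ (axisSquare 0 (2 * α))ᶜ ↔ w ∈ cornerRegion α := by
    simp [axisSquare, cornerRegion, hz]
    grind
  by_cases hw : w ∈ cornerRegion α
  · rw [Set.indicator_of_mem hw, Set.indicator_of_mem (h.2 hw), sub_sub_cancel]
  · rw [Set.indicator_of_notMem hw, Set.indicator_of_notMem fun h' => hw (h.1 h')]

theorem lt_norm_sub_of_mem_cornerRegion {α : ℝ} {z w : ℂ}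
    (hz : z = (α : ℂ) + Complex.I * (α : ℂ)) (hw : w ∈ cornerRegion α) : α < ‖z - w‖ := by
  rcases hw with h | h
  · have := Complex.abs_re_le_norm (z - w)
    simp [hz] at this
    exact h.trans_le (by simpa [hz] using this)
  · have := Complex.abs_im_le_norm (z - w)
    simp [hz] at this
    exact h.trans_le (by simpa [hz] using this)

/-- Within radius `α` of its corner the square of side `2α` looks like the closed first quadrant,
its far sides being out of reach. -/
theorem mem_cornerRegion_iff_of_norm_le {α : ℝ} {w : ℂ} (hw : ‖w‖ ≤ α) :
    w ∈ cornerRegion α ↔ ¬(0 ≤ w.re ∧ 0 ≤ w.im) := by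
  have h1 := abs_le.1 ((Complex.abs_re_le_norm w).trans hw)
  have h2 := abs_le.1 ((Complex.abs_im_le_norm w).trans hw)
  rw [cornerRegion, Set.mem_ofPred_eq, abs_of_nonneg (by linarith [h1.2] : 0 ≤ α - w.re),
    abs_of_nonneg (by linarith [h2.2] : 0 ≤ α - w.im)]
  constructor
  · rintro (h | h) ⟨h3, h4⟩ <;> linarith
  · intro h
    by_contra! h'
    exact h ⟨by linarith, by linarith⟩

theorem integrableOn_norm_sub_rpow {α : ℝ} (hα : 0 < α) (z : ℂ) :
    IntegrableOn (fun w => ‖z - w‖ ^ (-4 : ℝ)) {w : ℂ | α < ‖z - w‖} ∧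
    ∫ w in {w : ℂ | α < ‖z - w‖}, ‖z - w‖ ^ (-4 : ℝ) = Real.pi / α ^ 2 := by
  have hm := measurableSet_lt_norm α
  have hm' : MeasurableSet {w : ℂ | α < ‖z - w‖} :=
    measurableSet_lt measurable_const (measurable_id.const_sub z).norm
  have h := integrableOn_norm_rpow_outside (s := -4) (by norm_num) hα
  have h2 := setIntegral_norm_rpow_outside (s := -4) (by norm_num) hα
  have he : ∀ w, {w : ℂ | α < ‖w‖}.indicator (fun w => ‖w‖ ^ (-4 : ℝ)) (z - w) =
      {w : ℂ | α < ‖z - w‖}.indicator (fun w => ‖z - w‖ ^ (-4 : ℝ)) w := fun w => rfl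
  rw [← integrable_indicator_iff hm] at h
  rw [← integral_indicator hm, ← integral_sub_left_eq_self _ volume z] at h2
  have h3 := h.comp_sub_left z
  simp only [he] at h2 h3
  refine ⟨(integrable_indicator_iff hm').1 h3, ?_⟩
  rw [← integral_indicator hm', h2, show (-4 : ℝ) + 2 = -2 by norm_num, Real.rpow_neg hα.le]
  norm_num
  field_simp

theorem norm_beurlingKernel_le {α : ℝ} (hα : 0 < α) {w : ℂ} (hw : α < ‖w‖) :
    ‖beurlingKernel w‖ ≤ 1 / (Real.pi * α ^ 2) := by
  rw [norm_beurlingKernel]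
  gcongr

theorem integrableOn_transformBound : IntegrableOn transformBound (Metric.closedBall (0 : ℂ) 4) := by
  refine Integrable.mono' ((integrable_transformBound_sq.integrableOn.add
    (integrableOn_const (C := (1 : ℝ)) measure_closedBall_lt_top.ne)))
    measurable_transformBound.aestronglyMeasurable (.of_forall fun z => ?_)
  rw [Real.norm_of_nonneg (transformBound_nonneg z)]
  simp only [Pi.add_apply]
  nlinarith [sq_nonneg (transformBound z - 1)]

section Corner

variable {α : ℝ} {z : ℂ}

theorem integrableOn_corner (hα : 0 < α) (hz : z = (α : ℂ) + Complex.I * (α : ℂ)) :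
    IntegrableOn (fun w => beurlingInv squareInd w * beurlingKernel (z - w)) (cornerRegion α) := by
  have hsub : cornerRegion α ⊆ {w : ℂ | α < ‖z - w‖} := fun w hw =>
    lt_norm_sub_of_mem_cornerRegion hz hw
  refine Integrable.mono' (g := fun w => (transformBound w ^ 2 +
    1 / Real.pi ^ 2 * ‖z - w‖ ^ (-4 : ℝ)) / 2)
    ((integrable_transformBound_sq.integrableOn.add
      (((integrableOn_norm_sub_rpow hα z).1.mono_set hsub).const_mul _)).div_const 2) ?_ ?_
  · exact aestronglyMeasurable_beurlingInv_squareInd.restrict.mul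
      (measurable_beurlingKernel.comp (measurable_id.const_sub z)).aestronglyMeasurable
  · filter_upwards [ae_restrict_of_ae ae_edgeDist_pos,
      ae_restrict_mem (measurableSet_cornerRegion α)] with w hd hw
    have hp : 0 < ‖z - w‖ := hα.trans (hsub hw)
    rw [norm_mul]
    have h1 := norm_beurlingInv_squareInd_le hd
    refine (mul_le_half_sq_add_sq _ _).trans ?_
    have h2 : ‖beurlingKernel (z - w)‖ ^ 2 = 1 / Real.pi ^ 2 * ‖z - w‖ ^ (-4 : ℝ) := by
      rw [norm_beurlingKernel, Real.rpow_neg hp.le, show ‖z - w‖ ^ (4 : ℝ) = ‖z - w‖ ^ 4 by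
        exact_mod_cast Real.rpow_natCast ‖z - w‖ 4]
      field_simp
    rw [h2]
    gcongr

/-- Near the origin only local integrability of `f` is used: the kernel is at most `1/(πα²)` there.
-/
theorem norm_setIntegral_corner_near_le (hα : 0 < α) (hz : z = (α : ℂ) + Complex.I * (α : ℂ)) :
    ‖∫ w in cornerRegion α ∩ {w : ℂ | ‖w‖ ≤ 4},
      beurlingInv squareInd w * beurlingKernel (z - w)‖ ≤
      (∫ w in Metric.closedBall (0 : ℂ) 4, transformBound w) / Real.pi / α ^ 2 := by
  have hm4 : MeasurableSet {w : ℂ | ‖w‖ ≤ 4} := measurableSet_le measurable_norm measurable_const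
  have hS : cornerRegion α ∩ {w : ℂ | ‖w‖ ≤ 4} ⊆ Metric.closedBall (0 : ℂ) 4 := fun w hw => by
    simpa using hw.2
  have hm := (measurableSet_cornerRegion α).inter hm4
  calc _ ≤ ∫ w in cornerRegion α ∩ {w : ℂ | ‖w‖ ≤ 4},
        transformBound w * (1 / (Real.pi * α ^ 2)) := by
        refine norm_integral_le_of_norm_le
          ((integrableOn_transformBound.mono_set hS).mul_const _) ?_
        filter_upwards [ae_restrict_of_ae ae_edgeDist_pos, ae_restrict_mem hm] with w hd hw
        rw [norm_mul]
        have h1 := norm_beurlingInv_squareInd_le hd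
        have h2 := norm_beurlingKernel_le hα (lt_norm_sub_of_mem_cornerRegion hz hw.1)
        have := transformBound_nonneg w
        gcongr
    _ ≤ ∫ w in Metric.closedBall (0 : ℂ) 4, transformBound w * (1 / (Real.pi * α ^ 2)) :=
        setIntegral_mono_set (integrableOn_transformBound.mul_const _)
          (.of_forall fun w => mul_nonneg (transformBound_nonneg w) (by positivity))
          hS.eventuallyLE
    _ = _ := by
        rw [integral_mul_const]
        field_simp

/-- Both factors decay quadratically, about `0` and about `z`. The product is split into fourth
powers, each integrating to at most `π/α²` because `|w|` and `|z - w|` both exceed `α`. -/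
theorem norm_setIntegral_corner_far_le (hα : 4 ≤ α) (hz : z = (α : ℂ) + Complex.I * (α : ℂ)) :
    ‖∫ w in cornerRegion α ∩ {w : ℂ | α < ‖w‖},
      beurlingInv squareInd w * beurlingKernel (z - w)‖ ≤ 6 / α ^ 2 := by
  have hα0 : 0 < α := by linarith
  have hm := (measurableSet_cornerRegion α).inter (measurableSet_lt_norm α)
  have hS1 : cornerRegion α ∩ {w : ℂ | α < ‖w‖} ⊆ {w : ℂ | α < ‖w‖} := Set.inter_subset_right
  have hS2 : cornerRegion α ∩ {w : ℂ | α < ‖w‖} ⊆ {w : ℂ | α < ‖z - w‖} := fun w hw =>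
    lt_norm_sub_of_mem_cornerRegion hz hw.1
  have hi1 := integrableOn_norm_rpow_outside (s := -4) (by norm_num) hα0
  obtain ⟨hi2, hv2⟩ := integrableOn_norm_sub_rpow hα0 z
  have hv1 : ∫ w in {w : ℂ | α < ‖w‖}, ‖w‖ ^ (-4 : ℝ) = Real.pi / α ^ 2 := by
    simpa using (integrableOn_norm_sub_rpow hα0 0).2
  calc _ ≤ ∫ w in cornerRegion α ∩ {w : ℂ | α < ‖w‖},
        3 / Real.pi * (‖w‖ ^ (-4 : ℝ) + ‖z - w‖ ^ (-4 : ℝ)) := by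
        refine norm_integral_le_of_norm_le
          (((hi1.mono_set hS1).add (hi2.mono_set hS2)).const_mul _) ?_
        filter_upwards [ae_restrict_of_ae ae_edgeDist_pos, ae_restrict_mem hm] with w hd hw
        have hp1 : 4 < ‖w‖ := hα.trans_lt hw.2
        have hp2 : 0 < ‖z - w‖ := hα0.trans (hS2 hw)
        have h1 := norm_beurlingInv_squareInd_le hd
        rw [transformBound, if_neg (not_le.2 hp1)] at h1
        rw [norm_mul, norm_beurlingKernel, Real.rpow_neg hp2.le, Real.rpow_neg (by positivity),
          show ‖z - w‖ ^ (4 : ℝ) = ‖z - w‖ ^ 4 by exact_mod_cast Real.rpow_natCast ‖z - w‖ 4,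
          show ‖w‖ ^ (4 : ℝ) = ‖w‖ ^ 4 by exact_mod_cast Real.rpow_natCast ‖w‖ 4]
        calc _ ≤ 6 / ‖w‖ ^ 2 * (1 / (Real.pi * ‖z - w‖ ^ 2)) := by gcongr
          _ = 6 / Real.pi * ((‖w‖ ^ 2)⁻¹ * (‖z - w‖ ^ 2)⁻¹) := by field_simp
          _ ≤ 6 / Real.pi * ((((‖w‖ ^ 2)⁻¹) ^ 2 + ((‖z - w‖ ^ 2)⁻¹) ^ 2) / 2) := by
              gcongr
              exact mul_le_half_sq_add_sq _ _
          _ = _ := by ring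
    _ = 3 / Real.pi * ((∫ w in cornerRegion α ∩ {w : ℂ | α < ‖w‖}, ‖w‖ ^ (-4 : ℝ)) +
        ∫ w in cornerRegion α ∩ {w : ℂ | α < ‖w‖}, ‖z - w‖ ^ (-4 : ℝ)) := by
        rw [integral_const_mul, integral_add (hi1.mono_set hS1) (hi2.mono_set hS2)]
    _ ≤ 3 / Real.pi * (Real.pi / α ^ 2 + Real.pi / α ^ 2) := by
        gcongr
        · rw [← hv1]
          exact setIntegral_mono_set hi1 (.of_forall fun w => by positivity) hS1.eventuallyLE
        · rw [← hv2]
          exact setIntegral_mono_set hi2 (.of_forall fun w => by positivity) hS2.eventuallyLE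
    _ = _ := by
        have := Real.pi_ne_zero
        field_simp
        norm_num

theorem norm_corner (hα : 0 < α) (hz : z = (α : ℂ) + Complex.I * (α : ℂ)) :
    ‖z‖ = √2 * α := by
  rw [Complex.norm_def, Complex.normSq_apply, hz]
  simp
  rw [← two_mul, Real.sqrt_mul (by norm_num), Real.sqrt_mul_self hα.le]

/-- The full annulus contributes zero, so the three remaining quadrants give minus the integral over
the missing one. -/
theorem setIntegral_corner_conj_beurlingKernel (hα : 4 ≤ α) :
    ∫ w in cornerRegion α ∩ {w : ℂ | 4 < ‖w‖ ∧ ‖w‖ ≤ α}, conj (beurlingKernel w) =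
      Complex.I / Real.pi * Real.log (α / 4) := by
  have hr : Measurable Complex.re := Complex.measurable_re
  have hi : Measurable Complex.im := Complex.measurable_im
  have hmq : MeasurableSet {w : ℂ | 0 ≤ w.re ∧ 0 ≤ w.im} :=
    (measurableSet_le measurable_const hr).inter (measurableSet_le measurable_const hi)
  have hm : MeasurableSet {w : ℂ | 4 < ‖w‖ ∧ ‖w‖ ≤ α} := measurable_norm measurableSet_Ioc
  have h0 : ∫ w in {w : ℂ | 4 < ‖w‖ ∧ ‖w‖ ≤ α}, conj (beurlingKernel w) = 0 := by
    simp only [conj_beurlingKernel_eq]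
    exact setIntegral_eq_zero_of_I_mul (measurableSet_Ioc (a := 4) (b := α)) (kernelReg_I_mul 0)
  have hint : IntegrableOn (fun w => conj (beurlingKernel w)) {w : ℂ | 4 < ‖w‖ ∧ ‖w‖ ≤ α} := by
    have hfin : volume {w : ℂ | 4 < ‖w‖ ∧ ‖w‖ ≤ α} < ∞ :=
      (measure_mono fun w hw => by simpa using hw.2).trans_lt
        (measure_closedBall_lt_top (x := (0 : ℂ)) (r := α))
    refine Measure.integrableOn_of_bounded (M := 1 / (Real.pi * 4 ^ 2)) hfin.ne
      (Complex.continuous_conj.measurable.comp measurable_beurlingKernel).aestronglyMeasurable ?_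
    filter_upwards [ae_restrict_mem hm] with w hw
    rw [RCLike.norm_conj]
    exact norm_beurlingKernel_le (by norm_num) hw.1
  have hsplit := integral_inter_add_sdiff hmq hint
  rw [h0, setIntegral_quadrant_conj_beurlingKernel (by norm_num) hα] at hsplit
  have hset : cornerRegion α ∩ {w : ℂ | 4 < ‖w‖ ∧ ‖w‖ ≤ α} =
      {w : ℂ | 4 < ‖w‖ ∧ ‖w‖ ≤ α} \ {w : ℂ | 0 ≤ w.re ∧ 0 ≤ w.im} := by
    ext w
    constructor
    · rintro ⟨h1, h2⟩
      exact ⟨h2, (mem_cornerRegion_iff_of_norm_le h2.2).1 h1⟩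
    · rintro ⟨h2, h1⟩
      exact ⟨(mem_cornerRegion_iff_of_norm_le h2.2).2 h1, h2⟩
  rw [hset]
  linear_combination hsplit

/-- The first error replaces `f(w)` by its leading term, the second replaces `K(z - w)` by `K(z)`.
Over `4 < |w| ≤ α` both integrate to `O(α⁻²)` with no logarithm. -/
theorem norm_corner_integrand_sub_le (hα : 4 ≤ α) (hz : z = (α : ℂ) + Complex.I * (α : ℂ)) {w : ℂ}
    (hd : 0 < edgeDist w) (hw : w ∈ cornerRegion α) (h4 : 4 < ‖w‖) :
    ‖beurlingInv squareInd w * beurlingKernel (z - w) -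
      4 * beurlingKernel z * conj (beurlingKernel w)‖ ≤
      7 / α ^ 2 * ‖w‖ ^ (-3 : ℝ) + 1 / α ^ 3 * ‖w‖ ^ (-1 : ℝ) := by
  have hα0 : 0 < α := by linarith
  have hwp : 0 < ‖w‖ := by linarith
  have hzw := lt_norm_sub_of_mem_cornerRegion hz hw
  have hzwp : 0 < ‖z - w‖ := hα0.trans hzw
  have hzn := norm_corner hα0 hz
  have hs2 : √2 * √2 = 2 := Real.mul_self_sqrt (by norm_num)
  have hs1 : 1 ≤ √2 := Real.one_le_sqrt.2 (by norm_num)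
  have hpi := Real.pi_gt_three
  have hzp : α ≤ ‖z‖ := by rw [hzn]; nlinarith
  have hz0 : 0 < ‖z‖ := hα0.trans_le hzp
  have hzsq : ‖z‖ ^ 2 = 2 * α ^ 2 := by rw [hzn, mul_pow, sq √2, hs2]
  have e : beurlingInv squareInd w * beurlingKernel (z - w) -
      4 * beurlingKernel z * conj (beurlingKernel w) =
      (beurlingInv squareInd w - 4 * conj (beurlingKernel w)) * beurlingKernel (z - w) +
      4 * conj (beurlingKernel w) * (beurlingKernel (z - w) - beurlingKernel z) := by ring
  rw [e]
  refine (norm_add_le _ _).trans (add_le_add ?_ ?_)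
  · rw [norm_mul]
    calc _ ≤ 20 * ‖w‖ ^ (-3 : ℝ) * (1 / (Real.pi * α ^ 2)) := by
          gcongr
          · exact norm_beurlingInv_squareInd_sub_le h4 hd
          · exact norm_beurlingKernel_le hα0 hzw
      _ ≤ 20 * ‖w‖ ^ (-3 : ℝ) * (1 / (3 * α ^ 2)) := by gcongr
      _ = 20 / 3 / α ^ 2 * ‖w‖ ^ (-3 : ℝ) := by field_simp
      _ ≤ _ := by gcongr; norm_num
  · rw [norm_mul, norm_mul, RCLike.norm_conj, norm_beurlingKernel, Real.rpow_neg_one]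
    have h1 := norm_beurlingKernel_sub_le (norm_pos_iff.1 hz0) (norm_pos_iff.1 hzwp)
    rw [sub_sub_cancel] at h1
    have h2 : (‖z‖ + ‖z - w‖) / (‖z‖ ^ 2 * ‖z - w‖ ^ 2) ≤ 2 / α ^ 3 := by
      have : (‖z‖ + ‖z - w‖) / (‖z‖ ^ 2 * ‖z - w‖ ^ 2) =
        1 / (‖z‖ * ‖z - w‖ ^ 2) + 1 / (‖z‖ ^ 2 * ‖z - w‖) := by
        field_simp
      rw [this]
      calc _ ≤ 1 / (α * α ^ 2) + 1 / (α ^ 2 * α) := by gcongr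
        _ = _ := by field_simp; norm_num
    calc _ ≤ ‖(4 : ℂ)‖ * (1 / (Real.pi * ‖w‖ ^ 2)) *
          (‖w‖ * (‖z‖ + ‖z - w‖) / (Real.pi * ‖z‖ ^ 2 * ‖z - w‖ ^ 2)) := by gcongr
      _ = 4 / Real.pi ^ 2 * ((‖z‖ + ‖z - w‖) / (‖z‖ ^ 2 * ‖z - w‖ ^ 2)) * ‖w‖⁻¹ := by
          rw [show ‖(4 : ℂ)‖ = 4 by simp]
          field_simp
      _ ≤ 4 / 3 ^ 2 * (2 / α ^ 3) * ‖w‖⁻¹ := by gcongr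
      _ = 8 / 9 / α ^ 3 * ‖w‖⁻¹ := by ring
      _ ≤ _ := by gcongr; norm_num

theorem norm_setIntegral_corner_middle_sub_le (hα : 4 ≤ α)
    (hz : z = (α : ℂ) + Complex.I * (α : ℂ)) :
    ‖(∫ w in cornerRegion α ∩ {w : ℂ | 4 < ‖w‖ ∧ ‖w‖ ≤ α},
      beurlingInv squareInd w * beurlingKernel (z - w)) -
      4 * beurlingKernel z * (Complex.I / Real.pi * Real.log (α / 4))‖ ≤ 6 * Real.pi / α ^ 2 := by
  have hα0 : 0 < α := by linarith
  have hmA : MeasurableSet {w : ℂ | 4 < ‖w‖ ∧ ‖w‖ ≤ α} := measurable_norm measurableSet_Ioc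
  have hm := (measurableSet_cornerRegion α).inter hmA
  have hi1 := (integrableOn_corner hα0 hz).mono_set
    (Set.inter_subset_left (t := {w : ℂ | 4 < ‖w‖ ∧ ‖w‖ ≤ α}))
  have hi2 : IntegrableOn (fun w => conj (beurlingKernel w))
      (cornerRegion α ∩ {w : ℂ | 4 < ‖w‖ ∧ ‖w‖ ≤ α}) := by
    have hfin : volume (cornerRegion α ∩ {w : ℂ | 4 < ‖w‖ ∧ ‖w‖ ≤ α}) < ∞ :=
      (measure_mono fun w hw => by simpa using hw.2.2).trans_lt
        (measure_closedBall_lt_top (x := (0 : ℂ)) (r := α))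
    refine Measure.integrableOn_of_bounded (M := 1 / (Real.pi * 4 ^ 2)) hfin.ne
      (Complex.continuous_conj.measurable.comp measurable_beurlingKernel).aestronglyMeasurable ?_
    filter_upwards [ae_restrict_mem hm] with w hw
    rw [RCLike.norm_conj]
    exact norm_beurlingKernel_le (by norm_num) hw.2.1
  rw [← setIntegral_corner_conj_beurlingKernel hα, ← integral_const_mul,
    ← integral_sub hi1 (hi2.const_mul _)]
  have hS1 : cornerRegion α ∩ {w : ℂ | 4 < ‖w‖ ∧ ‖w‖ ≤ α} ⊆ {w : ℂ | 4 < ‖w‖} :=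
    fun w hw => hw.2.1
  have hS2 : cornerRegion α ∩ {w : ℂ | 4 < ‖w‖ ∧ ‖w‖ ≤ α} ⊆ {w : ℂ | 0 < ‖w‖ ∧ ‖w‖ ≤ α} :=
    fun w hw => ⟨by linarith [hw.2.1], hw.2.2⟩
  have hj1 := integrableOn_norm_rpow_outside (s := -3) (by norm_num) (by norm_num : (0 : ℝ) < 4)
  have hj2 := integrableOn_norm_rpow_punctured (s := -1) (by norm_num) hα0.le
  have hv1 := setIntegral_norm_rpow_outside (s := -3) (by norm_num) (by norm_num : (0 : ℝ) < 4)
  have hv2 := setIntegral_norm_rpow_punctured (s := -1) (by norm_num) hα0.le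
  calc _ ≤ ∫ w in cornerRegion α ∩ {w : ℂ | 4 < ‖w‖ ∧ ‖w‖ ≤ α},
        (7 / α ^ 2 * ‖w‖ ^ (-3 : ℝ) + 1 / α ^ 3 * ‖w‖ ^ (-1 : ℝ)) := by
        refine norm_integral_le_of_norm_le
          (((hj1.mono_set hS1).const_mul _).add ((hj2.mono_set hS2).const_mul _)) ?_
        filter_upwards [ae_restrict_of_ae ae_edgeDist_pos, ae_restrict_mem hm] with w hd hw
        exact norm_corner_integrand_sub_le hα hz hd hw.1 hw.2.1
    _ = 7 / α ^ 2 * (∫ w in cornerRegion α ∩ {w : ℂ | 4 < ‖w‖ ∧ ‖w‖ ≤ α}, ‖w‖ ^ (-3 : ℝ)) +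
        1 / α ^ 3 * ∫ w in cornerRegion α ∩ {w : ℂ | 4 < ‖w‖ ∧ ‖w‖ ≤ α}, ‖w‖ ^ (-1 : ℝ) := by
        rw [integral_add ((hj1.mono_set hS1).const_mul _) ((hj2.mono_set hS2).const_mul _),
          integral_const_mul, integral_const_mul]
    _ ≤ 7 / α ^ 2 * (∫ w in {w : ℂ | 4 < ‖w‖}, ‖w‖ ^ (-3 : ℝ)) +
        1 / α ^ 3 * ∫ w in {w : ℂ | 0 < ‖w‖ ∧ ‖w‖ ≤ α}, ‖w‖ ^ (-1 : ℝ) := by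
        refine add_le_add (mul_le_mul_of_nonneg_left ?_ (by positivity))
          (mul_le_mul_of_nonneg_left ?_ (by positivity))
        · exact setIntegral_mono_set hj1 (.of_forall fun w => by positivity) hS1.eventuallyLE
        · exact setIntegral_mono_set hj2 (.of_forall fun w => by positivity) hS2.eventuallyLE
    _ = (7 / 2 + 2) * Real.pi / α ^ 2 := by
        rw [hv1, hv2]
        norm_num
        field_simp
        norm_num
    _ ≤ _ := by
        gcongr
        norm_num

theorem exists_le_norm_beurlingSquareTruncation_corner : ∃ C : ℝ, ∀ α : ℝ, 4 ≤ α → ∀ z : ℂ,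
    z = (α : ℂ) + Complex.I * (α : ℂ) →
    (2 / Real.pi ^ 2 * Real.log (α / 4) - C) / α ^ 2 ≤
      ‖beurlingSquareTruncation (2 * α) (beurlingInv squareInd) z‖ := by
  refine ⟨(∫ w in Metric.closedBall (0 : ℂ) 4, transformBound w) / Real.pi + 6 + 6 * Real.pi,
    fun α hα z hz => ?_⟩
  have hα0 : 0 < α := by linarith
  set h := fun w => beurlingInv squareInd w * beurlingKernel (z - w) with hh
  have hi := integrableOn_corner hα0 hz
  have hm4 : MeasurableSet {w : ℂ | ‖w‖ ≤ 4} := measurableSet_le measurable_norm measurable_const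
  have hmα : MeasurableSet {w : ℂ | ‖w‖ ≤ α} := measurableSet_le measurable_norm measurable_const
  have s1 := integral_inter_add_sdiff hm4 hi
  have s2 := integral_inter_add_sdiff hmα (hi.mono_set
    (Set.sdiff_subset (t := {w : ℂ | ‖w‖ ≤ 4})))
  have e1 : (cornerRegion α \ {w : ℂ | ‖w‖ ≤ 4}) ∩ {w : ℂ | ‖w‖ ≤ α} =
      cornerRegion α ∩ {w : ℂ | 4 < ‖w‖ ∧ ‖w‖ ≤ α} := by
    ext w
    simp [and_assoc]
  have e2 : (cornerRegion α \ {w : ℂ | ‖w‖ ≤ 4}) \ {w : ℂ | ‖w‖ ≤ α} =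
      cornerRegion α ∩ {w : ℂ | α < ‖w‖} := by
    ext w
    simp only [Set.mem_sdiff, Set.mem_ofPred_eq, Set.mem_inter_iff, not_le]
    exact ⟨fun h => ⟨h.1.1, h.2⟩, fun h => ⟨⟨h.1, hα.trans_lt h.2⟩, h.2⟩⟩
  rw [e1, e2] at s2
  rw [beurlingSquareTruncation_corner _ hz, ← s1, ← s2]
  have b1 := norm_setIntegral_corner_near_le hα0 hz
  have b2 := norm_setIntegral_corner_middle_sub_le hα hz
  have b3 := norm_setIntegral_corner_far_le hα hz
  set J1 := ∫ w in cornerRegion α ∩ {w : ℂ | ‖w‖ ≤ 4},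
      beurlingInv squareInd w * beurlingKernel (z - w)
  set J2 := ∫ w in cornerRegion α ∩ {w : ℂ | 4 < ‖w‖ ∧ ‖w‖ ≤ α},
      beurlingInv squareInd w * beurlingKernel (z - w)
  set J3 := ∫ w in cornerRegion α ∩ {w : ℂ | α < ‖w‖},
      beurlingInv squareInd w * beurlingKernel (z - w)
  set m := 4 * beurlingKernel z * (Complex.I / Real.pi * Real.log (α / 4)) with hm
  have hmn : ‖m‖ = 2 / Real.pi ^ 2 * Real.log (α / 4) / α ^ 2 := by
    have hlog : 0 ≤ Real.log (α / 4) := Real.log_nonneg (by linarith)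
    rw [hm, norm_mul, norm_mul, norm_mul, norm_div, Complex.norm_I, norm_beurlingKernel,
      norm_corner hα0 hz, Complex.norm_real, Complex.norm_real, Real.norm_of_nonneg hlog,
      Real.norm_of_nonneg Real.pi_pos.le, mul_pow, Real.sq_sqrt (by norm_num)]
    rw [show ‖(4 : ℂ)‖ = 4 by simp]
    field_simp
    norm_num
  have htri : ‖m‖ ≤ ‖J1 + (J2 + J3)‖ + ‖J1‖ + ‖J2 - m‖ + ‖J3‖ := by
    have e : m = (J1 + (J2 + J3)) - J1 - (J2 - m) - J3 := by ring
    calc ‖m‖ = ‖(J1 + (J2 + J3)) - J1 - (J2 - m) - J3‖ := by rw [← e]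
      _ ≤ _ := (norm_sub_le _ _).trans (add_le_add ((norm_sub_le _ _).trans
        (add_le_add (norm_sub_le _ _) le_rfl)) le_rfl)
  rw [hmn] at htri
  rw [sub_div, add_div, add_div]
  linarith

end Corner

theorem exists_maximalBeurlingSquare_corner_ge : ∃ c : ℝ, 0 < c ∧ ∃ α₀ : ℝ, ∀ α : ℝ, α₀ ≤ α →
    ∀ z : ℂ, z = (α : ℂ) + Complex.I * (α : ℂ) →
    ENNReal.ofReal (c * (Real.log ‖z‖ / ‖z‖ ^ 2)) ≤
      maximalBeurlingSquare (beurlingInv squareInd) z := by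
  obtain ⟨C, hC⟩ := exists_le_norm_beurlingSquareTruncation_corner
  -- The threshold absorbs `C`, the shift `log 4`, and the `log 2` from `|z| = √2 α` into the slack
  -- left by choosing `c = 1/π²`.
  obtain ⟨α₀, hα₀⟩ := eventually_atTop.1 (Real.tendsto_log_atTop.eventually_ge_atTop
    (2 * Real.log 4 + Real.log 2 + Real.pi ^ 2 * |C|))
  refine ⟨1 / Real.pi ^ 2, by positivity, max 4 α₀, fun α hα z hz => ?_⟩
  have hα4 : 4 ≤ α := (le_max_left _ _).trans hα
  have hα0 : 0 < α := by linarith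
  have hL := hα₀ α ((le_max_right _ _).trans hα)
  have h1 := hC α hα4 z hz
  have h2 : 1 / Real.pi ^ 2 * (Real.log ‖z‖ / ‖z‖ ^ 2) ≤
      ‖beurlingSquareTruncation (2 * α) (beurlingInv squareInd) z‖ := by
    refine le_trans ?_ h1
    rw [norm_corner hα0 hz, mul_pow, Real.sq_sqrt (by norm_num), Real.log_mul (by positivity)
      hα0.ne', Real.log_sqrt (by norm_num), Real.log_div hα0.ne' (by norm_num)]
    have e : 1 / Real.pi ^ 2 * ((Real.log 2 / 2 + Real.log α) / (2 * α ^ 2)) =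
      (1 / Real.pi ^ 2 * ((Real.log 2 / 2 + Real.log α) / 2)) / α ^ 2 := by field_simp
    rw [e]
    gcongr
    have e2 : 2 / Real.pi ^ 2 * (Real.log α - Real.log 4) - C =
      1 / Real.pi ^ 2 * (2 * (Real.log α - Real.log 4) - Real.pi ^ 2 * C) := by
      field_simp
    rw [e2]
    gcongr
    have h3 : Real.pi ^ 2 * C ≤ Real.pi ^ 2 * |C| := by gcongr; exact le_abs_self C
    have h4 : 0 ≤ Real.pi ^ 2 * |C| := by positivity
    have h5 : 0 < Real.log 4 := Real.log_pos (by norm_num)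
    have h6 : 0 < Real.log 2 := Real.log_pos (by norm_num)
    linarith
  calc _ ≤ ENNReal.ofReal ‖beurlingSquareTruncation (2 * α) (beurlingInv squareInd) z‖ :=
        ENNReal.ofReal_le_ofReal h2
    _ = ‖beurlingSquareTruncation (2 * α) (beurlingInv squareInd) z‖ₑ := ofReal_norm _
    _ ≤ _ := le_iSup₂_of_le (2 * α) (by positivity) le_rfl

/-! ### The maximal function of `χ` and the conclusion -/

theorem hardyLittlewoodMaximal_congr_ae {f g : ℂ → ℂ} (h : f =ᵐ[volume] g) :
    hardyLittlewoodMaximal f = hardyLittlewoodMaximal g := by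
  ext z
  have (r : ℝ) : ∫⁻ w in Metric.ball z r, ‖f w‖ₑ = ∫⁻ w in Metric.ball z r, ‖g w‖ₑ :=
    lintegral_congr_ae (ae_restrict_of_ae (h.mono fun w hw => congrArg enorm hw))
  simp only [hardyLittlewoodMaximal, this]

theorem beurling_beurlingInv_squareInd_ae :
    beurling (beurlingInv squareInd) =ᵐ[volume] squareInd := by
  filter_upwards [ae_edgeDist_pos] with z hz
  exact (hasPrincipalValue_beurlingInv_squareInd hz).limUnder_eq

theorem setLIntegral_enorm_squareInd (S : Set ℂ) :
    ∫⁻ w in S, ‖squareInd w‖ₑ = volume (unitSquare ∩ S) := by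
  have : ∀ w, ‖squareInd w‖ₑ = unitSquare.indicator (fun _ => (1 : ℝ≥0∞)) w := by
    intro w
    by_cases h : w ∈ unitSquare <;> simp [squareInd, h]
  simp only [this]
  rw [lintegral_indicator measurableSet_unitSquare, setLIntegral_const, one_mul,
    Measure.restrict_apply measurableSet_unitSquare]

theorem volume_ball_eq_ofReal (z : ℂ) {r : ℝ} (hr : 0 ≤ r) :
    volume (Metric.ball z r) = ENNReal.ofReal (Real.pi * r ^ 2) := by
  rw [Complex.volume_ball, mul_comm, ENNReal.ofReal_mul Real.pi_pos.le, ENNReal.ofReal_pow hr]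
  congr 1
  rw [← NNReal.coe_real_pi, ENNReal.ofReal_coe_nnreal]

theorem hardyLittlewoodMaximal_squareInd_bounds {z : ℂ} (hz : 2 < ‖z‖) :
    ENNReal.ofReal (64⁻¹ * (1 / ‖z‖ ^ 2)) ≤ hardyLittlewoodMaximal squareInd z ∧
      hardyLittlewoodMaximal squareInd z ≤ ENNReal.ofReal (64 * (1 / ‖z‖ ^ 2)) := by
  have hz0 : 0 < ‖z‖ := by linarith
  have h4 : (4 : ℝ≥0∞) = ENNReal.ofReal 4 := by simp
  have hpi := Real.pi_pos
  constructor
  -- The disc of radius `2|z|` contains the whole square, since `|z| > 2 > 3/2`.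
  · refine le_trans ?_ (le_iSup₂_of_le (2 * ‖z‖) (by positivity) le_rfl)
    have hsub : unitSquare ⊆ Metric.ball z (2 * ‖z‖) := by
      intro w hw
      have h1 := norm_le_of_mem_unitSquare hw
      rw [mem_ball_iff_norm]
      have := norm_sub_le w z
      linarith
    rw [setLIntegral_enorm_squareInd, Set.inter_eq_self_of_subset_left hsub, volume_unitSquare,
      volume_ball_eq_ofReal z (by positivity), h4, ← ENNReal.ofReal_div_of_pos (by positivity)]
    apply ENNReal.ofReal_le_ofReal
    have e : 4 / (Real.pi * (2 * ‖z‖) ^ 2) = Real.pi⁻¹ * (1 / ‖z‖ ^ 2) := by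
      field_simp
      norm_num
    rw [e]
    gcongr
    linarith [Real.pi_lt_four]
  · refine iSup₂_le fun r hr => ?_
    rw [setLIntegral_enorm_squareInd]
    -- A disc of radius at most `|z|/4` misses the square, as `3|z|/4 > 3/2`; for larger ones the
    -- area 4 over `(|z|/4)²` gives the constant 64.
    by_cases hrz : ‖z‖ / 4 < r
    · rw [volume_ball_eq_ofReal z hr.le]
      calc _ ≤ ENNReal.ofReal 4 / ENNReal.ofReal (Real.pi * r ^ 2) := by
            gcongr
            rw [← h4, ← volume_unitSquare]
            exact measure_mono Set.inter_subset_left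
        _ = ENNReal.ofReal (4 / (Real.pi * r ^ 2)) :=
            (ENNReal.ofReal_div_of_pos (by positivity)).symm
        _ ≤ _ := by
            apply ENNReal.ofReal_le_ofReal
            calc 4 / (Real.pi * r ^ 2) ≤ 4 / (1 * (‖z‖ / 4) ^ 2) := by
                  gcongr
                  linarith [Real.pi_gt_three]
              _ = _ := by
                  field_simp
                  norm_num
    · have hempty : unitSquare ∩ Metric.ball z r = ∅ := by
        rw [Set.eq_empty_iff_forall_notMem]
        rintro w ⟨hw1, hw2⟩
        have h1 := norm_le_of_mem_unitSquare hw1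
        rw [mem_ball_iff_norm, norm_sub_rev] at hw2
        have h2 : ‖z‖ ≤ ‖w‖ + ‖z - w‖ := by simpa using norm_add_le w (z - w)
        linarith
      rw [hempty]
      simp

/-- A function of size at least `log |z| / |z|²` on the diagonal exceeds every multiple of a
function of size at most `|z|⁻²`. -/
theorem exists_mul_lt_of_diagonal_bounds {M N : ℂ → ℝ≥0∞} {c α₀ K : ℝ} (hc : 0 < c) (hK : 0 ≤ K)
    (hN : ∀ α : ℝ, α₀ ≤ α → ∀ z : ℂ, z = (α : ℂ) + Complex.I * (α : ℂ) →
      ENNReal.ofReal (c * (Real.log ‖z‖ / ‖z‖ ^ 2)) ≤ N z)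
    (hM : ∀ z : ℂ, 2 < ‖z‖ → M z ≤ ENNReal.ofReal (K * (1 / ‖z‖ ^ 2))) (C : ℝ≥0) :
    ∃ z : ℂ, 2 < ‖z‖ ∧ (C : ℝ≥0∞) * M z < N z := by
  obtain ⟨α₁, hα₁⟩ := eventually_atTop.1 (Real.tendsto_log_atTop.eventually_gt_atTop (C * K / c))
  set α := max 4 (max α₀ α₁) with hα
  have h4 : 4 ≤ α := le_max_left _ _
  have hα0 : 0 < α := by linarith
  have hz := norm_corner hα0 (rfl : (α : ℂ) + Complex.I * (α : ℂ) = _)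
  set z := (α : ℂ) + Complex.I * (α : ℂ) with hzdef
  have hge : α ≤ ‖z‖ := by
    rw [hz]
    have := Real.one_le_sqrt.2 (by norm_num : (1 : ℝ) ≤ 2)
    nlinarith
  have hz0 : 0 < ‖z‖ := hα0.trans_le hge
  have hlog := hα₁ ‖z‖ ((le_max_right _ _).trans ((le_max_right _ _).trans hge))
  rw [div_lt_iff₀ hc] at hlog
  refine ⟨z, by linarith, ?_⟩
  refine lt_of_lt_of_le ?_ (hN α ((le_max_left _ _).trans (le_max_right _ _)) z hzdef)
  calc (C : ℝ≥0∞) * M z ≤ C * ENNReal.ofReal (K * (1 / ‖z‖ ^ 2)) := by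
        gcongr
        exact hM z (by linarith)
    _ = ENNReal.ofReal (C * (K * (1 / ‖z‖ ^ 2))) := by
        rw [ENNReal.ofReal_mul C.coe_nonneg, ENNReal.ofReal_coe_nnreal]
    _ < _ := by
        have hCK : 0 ≤ C * K := by positivity
        rw [ENNReal.ofReal_lt_ofReal_iff]
        · rw [← mul_assoc, mul_one_div, mul_div_assoc', mul_comm c]
          gcongr
        · have : 0 < Real.log ‖z‖ := Real.log_pos (by linarith)
          positivity

theorem mainTheorem2 (χ f : ℂ → ℂ)
    (hχ : χ = (axisSquare 0 2).indicator (fun _ => (1 : ℂ)))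
    (hf : f = beurlingInv χ) :
    -- `f` is a well-defined function in `L²` with `B f = χ`
    (∀ᵐ z : ℂ, HasPrincipalValue (fun w => conj (beurlingKernel w)) χ z (f z)) ∧
    MemLp f 2 (volume : Measure ℂ) ∧
    (∀ᵐ z : ℂ, HasPrincipalValue beurlingKernel f z (χ z)) ∧
    -- lower bound on the diagonal
    (∃ c : ℝ, 0 < c ∧ ∃ α₀ : ℝ, ∀ α : ℝ, α₀ ≤ α → ∀ z : ℂ, z = (α : ℂ) + Complex.I * (α : ℂ) →
      ENNReal.ofReal (c * (Real.log ‖z‖ / ‖z‖ ^ 2)) ≤ maximalBeurlingSquare f z) ∧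
    -- size of the maximal function of `B f`
    (∃ C : ℝ, 1 ≤ C ∧ ∀ z : ℂ, 2 < ‖z‖ →
      ENNReal.ofReal (C⁻¹ * (1 / ‖z‖ ^ 2)) ≤ hardyLittlewoodMaximal (beurling f) z ∧
      hardyLittlewoodMaximal (beurling f) z ≤ ENNReal.ofReal (C * (1 / ‖z‖ ^ 2))) ∧
    -- the quotient is unbounded
    (∀ C : ℝ≥0, ∃ z : ℂ, 2 < ‖z‖ ∧
      (C : ℝ≥0∞) * hardyLittlewoodMaximal (beurling f) z < maximalBeurlingSquare f z) ∧
    -- hence no pointwise estimate by `M (B g)` holds on `L²`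
    ¬ ∃ C : ℝ≥0, ∀ g : ℂ → ℂ, MemLp g 2 (volume : Measure ℂ) → ∀ z : ℂ,
      maximalBeurlingSquare g z ≤ (C : ℝ≥0∞) * hardyLittlewoodMaximal (beurling g) z := by
  obtain rfl : χ = squareInd := hχ
  subst hf
  have hM : ∀ z : ℂ, 2 < ‖z‖ →
      ENNReal.ofReal (64⁻¹ * (1 / ‖z‖ ^ 2)) ≤
        hardyLittlewoodMaximal (beurling (beurlingInv squareInd)) z ∧
      hardyLittlewoodMaximal (beurling (beurlingInv squareInd)) z ≤
        ENNReal.ofReal (64 * (1 / ‖z‖ ^ 2)) := by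
    -- Since `B f = χ` is known only almost everywhere, the passage to `χ` uses that `M` does not
    -- see null sets.
    rw [hardyLittlewoodMaximal_congr_ae beurling_beurlingInv_squareInd_ae]
    exact fun z hz => hardyLittlewoodMaximal_squareInd_bounds hz
  obtain ⟨c, hc, α₀, hlow⟩ := exists_maximalBeurlingSquare_corner_ge
  have hunb := exists_mul_lt_of_diagonal_bounds hc (by norm_num) hlow fun z hz => (hM z hz).2
  refine ⟨?_, memLp_beurlingInv_squareInd, ?_, ⟨c, hc, α₀, hlow⟩, ⟨64, by norm_num, hM⟩, hunb, ?_⟩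
  · filter_upwards [ae_edgeDist_pos] with z hz
    rw [beurlingInv_squareInd hz]
    exact hasPrincipalValue_squareInd hz
  · filter_upwards [ae_edgeDist_pos] with z hz
    exact hasPrincipalValue_beurlingInv_squareInd hz
  · rintro ⟨C, hC⟩
    obtain ⟨z, -, hz⟩ := hunb C
    exact hz.not_ge (hC _ memLp_beurlingInv_squareInd z)
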